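/- Let $\omega\in\mathbb C$ be a primitive 8th root of unity, and put $$X=\begin{bmatrix}0&1\\1&0\end{bmatrix},\quad Z=\begin{bmatrix}1&0\\0&-1\end{bmatrix},\quad H=\tfrac1{\sqrt2}\begin{bmatrix}1&1\\1&-1\end{bmatrix},\quad S=\begin{bmatrix}1&0\\0&\omega^2\end{bmatrix},\quad CZ=\mathrm{diag}(1,1,1,-1).$$ For a $2\times2$ matrix $U$ and $1\le i\le n$ let $U_i=I_2^{\otimes(i-1)}\otimes U\otimes I_2^{\otimes(n-i)}$, and for $1\le i\le n-1$ let $CZ_{i\to i+1}=I_2^{\otimes(i-1)}\otimes CZ\otimes I_2^{\otimes(n-i-1)}$. Let $\mathrm{Pauli}_n=\langle X_1,\dots,X_n,Z_1,\dots,Z_n,\omega^2I\rangle\subseteq U(2^n)$, let $\mathrm{Cliff}_n$ be the normalizer of $\mathrm{Pauli}_n$ in the unitary group $U(2^n)$, and let $\mathcal C_n=\mathrm{Cliff}_n/\{cI: c\in\mathbb C,\ |c|=1\}$ be the $n$-qubit projective Clifford group. Let $h_i,s_i,\Lambda_i\in\mathcal C_n$ be the classes of $H_i$, $S_i$, $CZ_{i\to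 i+1}$. For every $n\ge1$, the centralizer of $\{s_1,\,h_1s_1h_1\}$ in $\mathcal C_n$ is $$\mathrm{Cent}_{\mathcal C_n}(\{s_1,h_1s_1h_1\})=\begin{cases}\{1\},&n=1,\\ \langle h_2,s_2\rangle,&n=2,\\ \langle h_2,\dots,h_n,\,s_2,\dots,s_n,\,\Lambda_2,\dots,\Lambda_{n-1}\rangle,&n\ge3.\end{cases}$$ Moreover, for $n\ge3$ this subgroup is a copy of $\mathcal C_{n-1}$ acting on the qubits $2,\dots,n$: the rule $[U]\mapsto[I_2\otimes U]$ for $U\in\mathrm{Cliff}_{n-1}$ is a well-defined injective group homomorphism $\mathcal C_{n-1}\to\mathcal C_n$ whose image is $\mathrm{Cent}_{\mathcal C_n}(\{s_1,h_1s_1h_1\})$. -/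

import Mathlib

open Matrix

namespace QubitClifford

noncomputable section

/-- Matrices acting on `n` qubits. The computational basis of `(ℂ²)^{⊗ n}` is indexed by the
bit strings `Fin n → Fin 2`. Qubits are numbered `0, …, n - 1`. -/
abbrev QMatrix (n : ℕ) : Type := Matrix (Fin n → Fin 2) (Fin n → Fin 2) ℂ

/-- The unitary group `U(2^n)` on `n` qubits. -/
abbrev QUnitary (n : ℕ) : Type := Matrix.unitaryGroup (Fin n → Fin 2) ℂ

/-- The tensor product `A_0 ⊗ ⋯ ⊗ A_{n-1}` of `2 × 2` matrices. -/
def tensor {n : ℕ} (A : Fin n → Matrix (Fin 2) (Fin 2) ℂ) : QMatrix n :=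
  Matrix.of fun x y => ∏ j, A j (x j) (y j)

/-- `I ⊗ ⋯ ⊗ I ⊗ U ⊗ I ⊗ ⋯ ⊗ I` with `U` at position `i`. -/
def onQubit {n : ℕ} (i : Fin n) (U : Matrix (Fin 2) (Fin 2) ℂ) : QMatrix n :=
  tensor (Function.update (fun _ => 1) i U)

/-- `I₂ ⊗ U`, the matrix `U` acting on all qubits but the first. -/
def idTensor {m : ℕ} (U : QMatrix m) : QMatrix (m + 1) :=
  Matrix.of fun x y => (1 : Matrix (Fin 2) (Fin 2) ℂ) (x 0) (y 0) * U (Fin.tail x) (Fin.tail y)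

theorem tensor_mul {n : ℕ} (A B : Fin n → Matrix (Fin 2) (Fin 2) ℂ) :
    tensor A * tensor B = tensor (fun j => A j * B j) := by
  ext x y
  simp only [tensor, Matrix.mul_apply, Matrix.of_apply, ← Finset.prod_mul_distrib]
  rw [Finset.prod_univ_sum, Fintype.piFinset_univ]

theorem tensor_one {n : ℕ} :
    tensor (fun _ : Fin n => (1 : Matrix (Fin 2) (Fin 2) ℂ)) = 1 := by
  ext x y
  simp only [tensor, Matrix.of_apply, Matrix.one_apply]
  by_cases h : x = y
  · simp [h]
  · obtain ⟨j, hj⟩ := Function.ne_iff.mp h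
    rw [if_neg h]
    exact Finset.prod_eq_zero (Finset.mem_univ j) (by simp [hj])

theorem tensor_star {n : ℕ} (A : Fin n → Matrix (Fin 2) (Fin 2) ℂ) :
    star (tensor A) = tensor (fun j => star (A j)) := by
  ext x y
  simp [tensor, Matrix.star_apply]

theorem onQubit_mul {n : ℕ} (i : Fin n) (U V : Matrix (Fin 2) (Fin 2) ℂ) :
    onQubit i U * onQubit i V = onQubit i (U * V) := by
  rw [onQubit, onQubit, tensor_mul, onQubit]
  congr 1
  funext j
  by_cases h : j = i
  · subst h; simp
  · simp [h]

theorem onQubit_one {n : ℕ} (i : Fin n) : onQubit i 1 = 1 := by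
  rw [onQubit, ← tensor_one]
  congr 1
  funext j
  by_cases h : j = i
  · subst h; simp
  · simp [h]

theorem onQubit_star {n : ℕ} (i : Fin n) (U : Matrix (Fin 2) (Fin 2) ℂ) :
    star (onQubit i U) = onQubit i (star U) := by
  rw [onQubit, tensor_star, onQubit]
  congr 1
  funext j
  by_cases h : j = i
  · subst h; simp
  · simp [h]

theorem onQubit_comm {n : ℕ} {i j : Fin n} (hij : i ≠ j) (U V : Matrix (Fin 2) (Fin 2) ℂ) :
    onQubit i U * onQubit j V = onQubit j V * onQubit i U := by
  rw [onQubit, onQubit, tensor_mul, tensor_mul]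
  congr 1
  funext k
  by_cases h : k = i
  · subst h; simp [hij]
  · simp [h]

theorem onQubit_apply {n : ℕ} (i : Fin n) (U : Matrix (Fin 2) (Fin 2) ℂ) (x y : Fin n → Fin 2) :
    onQubit i U x y = if ∀ k, k ≠ i → x k = y k then U (x i) (y i) else 0 := by
  simp only [onQubit, tensor, Matrix.of_apply]
  split_ifs with h
  · rw [Finset.prod_eq_single i]
    · simp
    · intro k _ hk
      simp [hk, h k hk]
    · simp
  · push Not at h
    obtain ⟨k, hk, hne⟩ := h
    exact Finset.prod_eq_zero (Finset.mem_univ k) (by simp [hk, hne])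

/-- A one-qubit gate `U` placed on qubit `i`. -/
def gateOn {n : ℕ} (i : Fin n) (U : Matrix.unitaryGroup (Fin 2) ℂ) : QUnitary n :=
  ⟨onQubit i U, by
    rw [Matrix.mem_unitaryGroup_iff, onQubit_star, onQubit_mul,
      Matrix.mem_unitaryGroup_iff.mp U.2, onQubit_one]⟩

/-- The Pauli matrix `X`. -/
def matX : Matrix.unitaryGroup (Fin 2) ℂ :=
  ⟨!![0, 1; 1, 0], by
    rw [Matrix.mem_unitaryGroup_iff]
    ext i j; fin_cases i <;> fin_cases j <;> simp [Matrix.mul_apply, Matrix.star_apply]⟩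

/-- The Pauli matrix `Z`. -/
def matZ : Matrix.unitaryGroup (Fin 2) ℂ :=
  ⟨!![1, 0; 0, -1], by
    rw [Matrix.mem_unitaryGroup_iff]
    ext i j; fin_cases i <;> fin_cases j <;> simp [Matrix.mul_apply, Matrix.star_apply]⟩

theorem inv_sqrt_two_mul_self : ((Real.sqrt 2 : ℂ))⁻¹ * ((Real.sqrt 2 : ℂ))⁻¹ = 1 / 2 := by
  rw [← mul_inv, ← Complex.ofReal_mul, Real.mul_self_sqrt (by norm_num)]
  norm_num

/-- The Hadamard matrix `H`. -/
def matH : Matrix.unitaryGroup (Fin 2) ℂ :=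
  ⟨((Real.sqrt 2 : ℂ))⁻¹ • !![1, 1; 1, -1], by
    rw [Matrix.mem_unitaryGroup_iff]
    ext i j
    fin_cases i <;> fin_cases j <;>
      simp [Matrix.mul_apply, Matrix.star_apply, inv_sqrt_two_mul_self] <;> norm_num⟩

theorem mul_conj_root {ω : ℂ} (hω : IsPrimitiveRoot ω 8) : ω * star ω = 1 := by
  have h : ‖ω‖ = 1 := hω.norm'_eq_one (by norm_num)
  have h2 := Complex.mul_conj ω
  rw [Complex.normSq_eq_norm_sq, h] at h2
  simpa using h2

theorem root_pow_four {ω : ℂ} (hω : IsPrimitiveRoot ω 8) : ω ^ 4 = -1 := by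
  have h : (ω ^ 4 - 1) * (ω ^ 4 + 1) = 0 := by
    have := hω.pow_eq_one
    linear_combination this
  rcases mul_eq_zero.mp h with h | h
  · exact absurd (sub_eq_zero.mp h) (hω.pow_ne_one_of_pos_of_lt (by norm_num) (by norm_num))
  · linear_combination h

/-- The phase matrix `S = diag(1, ω²)`, where `ω` is a primitive eighth root of unity. -/
def matS {ω : ℂ} (hω : IsPrimitiveRoot ω 8) : Matrix.unitaryGroup (Fin 2) ℂ :=
  ⟨!![1, 0; 0, ω ^ 2], by
    have h := mul_conj_root hω
    have h2 : ω ^ 2 * (star ω) ^ 2 = 1 := by rw [← mul_pow, h, one_pow]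
    rw [Matrix.mem_unitaryGroup_iff]
    ext i j; fin_cases i <;> fin_cases j <;>
      simp [Matrix.mul_apply, Matrix.star_apply]
    simpa using h2⟩

/-- The scalar matrix `ω² I`. -/
def scalarI {ω : ℂ} (hω : IsPrimitiveRoot ω 8) (n : ℕ) : QUnitary n :=
  ⟨(ω ^ 2) • (1 : QMatrix n), by
    have h2 : ω ^ 2 * (star ω) ^ 2 = 1 := by rw [← mul_pow, mul_conj_root hω, one_pow]
    rw [Matrix.mem_unitaryGroup_iff, star_smul, star_one, smul_mul_smul_comm, star_pow, h2]
    simp⟩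

/-- The controlled `Z` gate on qubits `i` and `i + 1` of `m + 1` qubits: the diagonal matrix whose
sign is `-1` exactly on the basis states where both qubits are `1`. -/
def gateCZ {m : ℕ} (i : Fin m) : QUnitary (m + 1) :=
  ⟨Matrix.diagonal fun x => if x i.castSucc = 1 ∧ x i.succ = 1 then -1 else 1, by
    rw [Matrix.mem_unitaryGroup_iff, Matrix.star_eq_conjTranspose,
      Matrix.diagonal_conjTranspose, Matrix.diagonal_mul_diagonal, ← Matrix.diagonal_one]
    congr 1
    funext x
    simp only [Pi.star_apply]
    split_ifs <;> simp⟩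

/-- The `n`-qubit Pauli group, generated by the `X_i`, the `Z_i` and `ω² I`. -/
def pauliGroup {ω : ℂ} (hω : IsPrimitiveRoot ω 8) (n : ℕ) : Subgroup (QUnitary n) :=
  Subgroup.closure
    (Set.range (fun i => gateOn i matX) ∪ Set.range (fun i => gateOn i matZ) ∪ {scalarI hω n})

/-- The `n`-qubit Clifford group: the normalizer of the Pauli group in `U(2^n)`. -/
def cliffordGroup {ω : ℂ} (hω : IsPrimitiveRoot ω 8) (n : ℕ) : Subgroup (QUnitary n) :=
  Subgroup.normalizer (pauliGroup hω n : Set (QUnitary n))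

/-- The global phases: the scalar matrices in the Clifford group. -/
def globalPhases {ω : ℂ} (hω : IsPrimitiveRoot ω 8) (n : ℕ) : Subgroup (cliffordGroup hω n) where
  carrier := {U | ∃ c : ℂ, ((U : QUnitary n) : QMatrix n) = c • (1 : QMatrix n)}
  one_mem' := ⟨1, by simp⟩
  mul_mem' := by
    rintro U V ⟨c, hc⟩ ⟨d, hd⟩
    exact ⟨c * d, by simp [hc, hd, smul_smul, mul_comm]⟩
  inv_mem' := by
    rintro U ⟨c, hc⟩
    exact ⟨star c, by simp [hc, Matrix.UnitaryGroup.inv_val]⟩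

instance globalPhases_normal {ω : ℂ} (hω : IsPrimitiveRoot ω 8) (n : ℕ) :
    (globalPhases hω n).Normal where
  conj_mem := by
    rintro U ⟨c, hc⟩ V
    refine ⟨c, ?_⟩
    have h : ((V : QUnitary n) : QMatrix n) * star ((V : QUnitary n) : QMatrix n) = 1 :=
      Matrix.mem_unitaryGroup_iff.mp (V : QUnitary n).2
    simp [hc, Matrix.UnitaryGroup.inv_val, h]

/-- The projective Clifford group `𝒞_n`: Clifford operators up to a global phase. -/
abbrev ProjClifford {ω : ℂ} (hω : IsPrimitiveRoot ω 8) (n : ℕ) : Type :=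
  cliffordGroup hω n ⧸ globalPhases hω n

theorem gateOn_mul {n : ℕ} (i : Fin n) (U V : Matrix.unitaryGroup (Fin 2) ℂ) :
    gateOn i U * gateOn i V = gateOn i (U * V) :=
  Subtype.ext (onQubit_mul i _ _)

theorem gateOn_comm {n : ℕ} {i j : Fin n} (hij : i ≠ j) (U V : Matrix.unitaryGroup (Fin 2) ℂ) :
    gateOn i U * gateOn j V = gateOn j V * gateOn i U :=
  Subtype.ext (onQubit_comm hij _ _)

theorem gateOn_one {n : ℕ} (i : Fin n) : gateOn i 1 = 1 :=
  Subtype.ext (onQubit_one i)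

theorem X_mem {ω : ℂ} (hω : IsPrimitiveRoot ω 8) {n : ℕ} (i : Fin n) :
    gateOn i matX ∈ pauliGroup hω n :=
  Subgroup.subset_closure (Or.inl (Or.inl ⟨i, rfl⟩))

theorem Z_mem {ω : ℂ} (hω : IsPrimitiveRoot ω 8) {n : ℕ} (i : Fin n) :
    gateOn i matZ ∈ pauliGroup hω n :=
  Subgroup.subset_closure (Or.inl (Or.inr ⟨i, rfl⟩))

theorem scalarI_mem {ω : ℂ} (hω : IsPrimitiveRoot ω 8) (n : ℕ) :
    scalarI hω n ∈ pauliGroup hω n :=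
  Subgroup.subset_closure (Or.inr rfl)

/-- A unitary of finite order that conjugates each `X_i` and `Z_i` into the Pauli group is
Clifford. -/
theorem mem_clifford {ω : ℂ} (hω : IsPrimitiveRoot ω 8) {n : ℕ} (U : QUnitary n) (k : ℕ)
    (hk : U ^ (k + 1) = 1)
    (hX : ∀ j, ∃ P ∈ pauliGroup hω n, U * gateOn j matX = P * U)
    (hZ : ∀ j, ∃ P ∈ pauliGroup hω n, U * gateOn j matZ = P * U) :
    U ∈ cliffordGroup hω n := by
  have h1 : ∀ P ∈ pauliGroup hω n, U * P * U⁻¹ ∈ pauliGroup hω n := by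
    have h : pauliGroup hω n ≤ (pauliGroup hω n).comap (MulAut.conj U).toMonoidHom := by
      conv_lhs => rw [pauliGroup]
      rw [Subgroup.closure_le]
      rintro _ ((⟨j, rfl⟩ | ⟨j, rfl⟩) | rfl)
      · obtain ⟨P, hP, e⟩ := hX j
        simpa [e] using hP
      · obtain ⟨P, hP, e⟩ := hZ j
        simpa [e] using hP
      · have e : U * scalarI hω n = scalarI hω n * U := by
          apply Subtype.ext
          simp [scalarI]
        simpa [e] using scalarI_mem hω n
    intro P hP
    simpa using h hP
  have h2 : ∀ r : ℕ, ∀ P ∈ pauliGroup hω n, U ^ r * P * (U ^ r)⁻¹ ∈ pauliGroup hω n := by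
    intro r
    induction r with
    | zero => simp
    | succ r ih =>
      intro P hP
      have := h1 _ (ih P hP)
      simpa [pow_succ', mul_assoc] using this
  have h3 : U ^ k = U⁻¹ := by
    rw [eq_inv_iff_mul_eq_one, ← pow_succ, hk]
  rw [cliffordGroup, Subgroup.mem_normalizer_iff]
  refine fun P => ⟨h1 P, fun hP => ?_⟩
  have := h2 k _ hP
  rw [h3] at this
  simpa [mul_assoc] using this

theorem matH_sq : matH * matH = 1 := by
  apply Subtype.ext
  ext i j
  fin_cases i <;> fin_cases j <;>
    simp [matH, inv_sqrt_two_mul_self] <;> norm_num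

theorem matH_X : matH * matX = matZ * matH := by
  apply Subtype.ext
  ext i j
  fin_cases i <;> fin_cases j <;> simp [matH, matX, matZ]

theorem matH_Z : matH * matZ = matX * matH := by
  apply Subtype.ext
  ext i j
  fin_cases i <;> fin_cases j <;> simp [matH, matX, matZ]

theorem gateH_mem {ω : ℂ} (hω : IsPrimitiveRoot ω 8) {n : ℕ} (i : Fin n) :
    gateOn i matH ∈ cliffordGroup hω n := by
  refine mem_clifford hω _ 1 ?_ (fun j => ?_) (fun j => ?_)
  · rw [pow_succ, pow_one, gateOn_mul, matH_sq, gateOn_one]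
  · by_cases h : i = j
    · subst h
      exact ⟨_, Z_mem hω i, by rw [gateOn_mul, gateOn_mul, matH_X]⟩
    · exact ⟨_, X_mem hω j, gateOn_comm h _ _⟩
  · by_cases h : i = j
    · subst h
      exact ⟨_, X_mem hω i, by rw [gateOn_mul, gateOn_mul, matH_Z]⟩
    · exact ⟨_, Z_mem hω j, gateOn_comm h _ _⟩

theorem matS_pow {ω : ℂ} (hω : IsPrimitiveRoot ω 8) :
    matS hω * matS hω * (matS hω * matS hω) = 1 := by
  have h := hω.pow_eq_one
  apply Subtype.ext
  ext i j
  fin_cases i <;> fin_cases j <;> simp [matS]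
  linear_combination h

theorem matS_Z {ω : ℂ} (hω : IsPrimitiveRoot ω 8) : matS hω * matZ = matZ * matS hω := by
  apply Subtype.ext
  ext i j
  fin_cases i <;> fin_cases j <;> simp [matS, matZ]

theorem matS_X {ω : ℂ} (hω : IsPrimitiveRoot ω 8) :
    ((matS hω * matX : Matrix.unitaryGroup (Fin 2) ℂ) : Matrix (Fin 2) (Fin 2) ℂ) =
      ω ^ 2 • ((matX * matZ * matS hω : Matrix.unitaryGroup (Fin 2) ℂ) :
        Matrix (Fin 2) (Fin 2) ℂ) := by
  have h := root_pow_four hω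
  ext i j
  fin_cases i <;> fin_cases j <;> simp [matS, matX, matZ]
  linear_combination h

theorem onQubit_smul {n : ℕ} (i : Fin n) (c : ℂ) (U : Matrix (Fin 2) (Fin 2) ℂ) :
    onQubit i (c • U) = c • onQubit i U := by
  ext x y
  simp [onQubit_apply]

theorem gateS_mem {ω : ℂ} (hω : IsPrimitiveRoot ω 8) {n : ℕ} (i : Fin n) :
    gateOn i (matS hω) ∈ cliffordGroup hω n := by
  refine mem_clifford hω _ 3 ?_ (fun j => ?_) (fun j => ?_)
  · have : gateOn i (matS hω) ^ (3 + 1) =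
        gateOn i (matS hω) * gateOn i (matS hω) * (gateOn i (matS hω) * gateOn i (matS hω)) := by
      simp only [pow_succ, pow_zero, one_mul, mul_assoc]
    rw [this, gateOn_mul, gateOn_mul, matS_pow, gateOn_one]
  · by_cases h : i = j
    · subst h
      refine ⟨scalarI hω n * (gateOn i matX * gateOn i matZ),
        mul_mem (scalarI_mem hω n) (mul_mem (X_mem hω i) (Z_mem hω i)), ?_⟩
      rw [mul_assoc, gateOn_mul, gateOn_mul, gateOn_mul]
      apply Subtype.ext
      change onQubit i _ = (ω ^ 2 • (1 : QMatrix n)) * onQubit i _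
      rw [smul_mul_assoc, one_mul, ← onQubit_smul, matS_X]
    · exact ⟨_, X_mem hω j, gateOn_comm h _ _⟩
  · by_cases h : i = j
    · subst h
      exact ⟨_, Z_mem hω i, by rw [gateOn_mul, gateOn_mul, matS_Z]⟩
    · exact ⟨_, Z_mem hω j, gateOn_comm h _ _⟩

theorem onQubit_Z {n : ℕ} (i : Fin n) :
    onQubit i (matZ : Matrix (Fin 2) (Fin 2) ℂ) =
      Matrix.diagonal fun x => if x i = 1 then -1 else 1 := by
  ext x y
  rw [onQubit_apply, Matrix.diagonal_apply]
  by_cases h : x = y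
  · subst h
    rcases Fin.exists_fin_two.mp ⟨x i, rfl⟩ with h | h <;> simp [matZ, h]
  · rw [if_neg h]
    split_ifs with hk
    · have hi : x i ≠ y i := by
        intro hi
        apply h
        funext k
        by_cases hki : k = i
        · rw [hki, hi]
        · exact hk k hki
      generalize x i = a at hi
      generalize y i = b at hi
      fin_cases a <;> fin_cases b <;> simp_all [matZ]
    · rfl

theorem gateCZ_sq {m : ℕ} (i : Fin m) : gateCZ i * gateCZ i = 1 := by
  apply Subtype.ext
  change Matrix.diagonal _ * Matrix.diagonal _ = (1 : QMatrix (m + 1))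
  rw [Matrix.diagonal_mul_diagonal, ← Matrix.diagonal_one]
  congr 1
  funext x
  split_ifs <;> simp

theorem gateCZ_Z {m : ℕ} (i : Fin m) (j : Fin (m + 1)) :
    gateCZ i * gateOn j matZ = gateOn j matZ * gateCZ i := by
  apply Subtype.ext
  change Matrix.diagonal _ * onQubit j _ = onQubit j _ * Matrix.diagonal _
  rw [onQubit_Z, Matrix.diagonal_mul_diagonal, Matrix.diagonal_mul_diagonal]
  congr 1
  funext x
  exact mul_comm _ _

theorem gateCZ_X_other {m : ℕ} (i : Fin m) (j : Fin (m + 1)) (h1 : j ≠ i.castSucc)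
    (h2 : j ≠ i.succ) : gateCZ i * gateOn j matX = gateOn j matX * gateCZ i := by
  apply Subtype.ext
  change Matrix.diagonal _ * onQubit j _ = onQubit j _ * Matrix.diagonal _
  ext x y
  rw [Matrix.diagonal_mul, Matrix.mul_diagonal, onQubit_apply]
  by_cases h : ∀ k, k ≠ j → x k = y k
  · rw [h _ h1.symm, h _ h2.symm, mul_comm]
  · simp [h]

theorem gateCZ_X_left {m : ℕ} (i : Fin m) :
    gateCZ i * gateOn i.castSucc matX =
      gateOn i.castSucc matX * gateOn i.succ matZ * gateCZ i := by
  have hne : i.succ ≠ i.castSucc := i.castSucc_lt_succ.ne'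
  apply Subtype.ext
  change Matrix.diagonal _ * onQubit _ _ = onQubit _ _ * onQubit _ _ * Matrix.diagonal _
  rw [onQubit_Z]
  ext x y
  rw [Matrix.diagonal_mul, Matrix.mul_diagonal, Matrix.mul_diagonal, onQubit_apply]
  by_cases h : ∀ k, k ≠ i.castSucc → x k = y k
  · rw [h _ hne, if_pos h]
    generalize x i.castSucc = a
    generalize y i.castSucc = b
    generalize y i.succ = c
    fin_cases a <;> fin_cases b <;> fin_cases c <;> simp [matX]
  · simp [h]

theorem gateCZ_X_right {m : ℕ} (i : Fin m) :
    gateCZ i * gateOn i.succ matX =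
      gateOn i.succ matX * gateOn i.castSucc matZ * gateCZ i := by
  have hne : i.castSucc ≠ i.succ := i.castSucc_lt_succ.ne
  apply Subtype.ext
  change Matrix.diagonal _ * onQubit _ _ = onQubit _ _ * onQubit _ _ * Matrix.diagonal _
  rw [onQubit_Z]
  ext x y
  rw [Matrix.diagonal_mul, Matrix.mul_diagonal, Matrix.mul_diagonal, onQubit_apply]
  by_cases h : ∀ k, k ≠ i.succ → x k = y k
  · rw [h _ hne, if_pos h]
    generalize x i.succ = a
    generalize y i.succ = b
    generalize y i.castSucc = c
    fin_cases a <;> fin_cases b <;> fin_cases c <;> simp [matX]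
  · simp [h]

theorem gateCZ_mem {ω : ℂ} (hω : IsPrimitiveRoot ω 8) {m : ℕ} (i : Fin m) :
    gateCZ i ∈ cliffordGroup hω (m + 1) := by
  refine mem_clifford hω _ 1 ?_ (fun j => ?_) (fun j => ?_)
  · rw [pow_succ, pow_one, gateCZ_sq]
  · by_cases h1 : j = i.castSucc
    · subst h1
      exact ⟨_, mul_mem (X_mem hω _) (Z_mem hω _), gateCZ_X_left i⟩
    · by_cases h2 : j = i.succ
      · subst h2
        exact ⟨_, mul_mem (X_mem hω _) (Z_mem hω _), gateCZ_X_right i⟩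
      · exact ⟨_, X_mem hω j, gateCZ_X_other i j h1 h2⟩
  · exact ⟨_, Z_mem hω j, gateCZ_Z i j⟩

/-- The quotient map from the Clifford group to the projective Clifford group. -/
def proj {ω : ℂ} (hω : IsPrimitiveRoot ω 8) (n : ℕ) : cliffordGroup hω n →* ProjClifford hω n :=
  QuotientGroup.mk' (globalPhases hω n)

/-- The class of the Hadamard gate on qubit `i`. -/
def hGate {ω : ℂ} (hω : IsPrimitiveRoot ω 8) {n : ℕ} (i : Fin n) : ProjClifford hω n :=
  proj hω n ⟨gateOn i matH, gateH_mem hω i⟩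

/-- The class of the phase gate on qubit `i`. -/
def sGate {ω : ℂ} (hω : IsPrimitiveRoot ω 8) {n : ℕ} (i : Fin n) : ProjClifford hω n :=
  proj hω n ⟨gateOn i (matS hω), gateS_mem hω i⟩

/-- The class of the controlled `Z` gate on qubits `i` and `i + 1`. -/
def lamGate {ω : ℂ} (hω : IsPrimitiveRoot ω 8) {m : ℕ} (i : Fin m) : ProjClifford hω (m + 1) :=
  proj hω (m + 1) ⟨gateCZ i, gateCZ_mem hω i⟩

/-- The common centralizer of `s` and `h s h` on the first qubit. -/
def commonCentralizer {ω : ℂ} (hω : IsPrimitiveRoot ω 8) (m : ℕ) :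
    Subgroup (ProjClifford hω (m + 1)) :=
  Subgroup.centralizer {sGate hω 0, hGate hω 0 * sGate hω 0 * hGate hω 0}

end

end QubitClifford

namespace QubitClifford

/-! ### The embedding `U ↦ I ⊗ U` -/

/-! Two classes commute in the projective group when representatives satisfy `U A = c A U` for some
scalar `c`. Taking traces of `U⁻¹ U A = c U⁻¹ A U` gives `tr A = c tr A`, so `c = 1` as soon as `tr
A ≠ 0` (`PhaseConj.comm_of_trace_ne_zero`). Both `S` and `HSH` have trace `1 + ω² ≠ 0`, hence a `U`
centralizing both classes commutes with the matrices themselves, and so with their squares `Z` and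
`X` on the first qubit. These generate all of `M₂(ℂ)` there, so `U = I ⊗ V`
(`exists_idTensorHom_eq`). Since `I ⊗ P` is Pauli exactly when `P` is, `V` is again Clifford. Thus
the centralizer is the image of `[V] ↦ [I ⊗ V]` (`range_projEmb`), which is injective because `I ⊗
V` is scalar only for scalar `V`.

It remains to generate this image by gates, that is, to generate the Clifford group modulo phases
(`exists_gateGroup_phase`), by induction on the number of qubits. For a Clifford `U`, the image of
`X_0` is a nonscalar Pauli operator, and gates bring it back to `X_0` (`exists_conj_X`). The image
of `Z_0` then fails to commute with `X_0`, and gates fixing `X_0` bring it to `Z_0`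
(`exists_conj_Z`). All this holds up to phases, which must be signs since `X² = Z² = 1`; a Pauli
operator on the first qubit removes them (`exists_mul_commute`). What is left commutes with `X_0`
and `Z_0`, so it is `I ⊗ V` with `V` Clifford on one qubit fewer. -/

theorem idTensor_apply_cons {m : ℕ} (U : QMatrix m) (a b : Fin 2) (x y : Fin m → Fin 2) :
    idTensor U (Fin.cons a x) (Fin.cons b y) = if a = b then U x y else 0 := by
  simp [idTensor, Matrix.one_apply]

/-- Separating the first bit from the tail presents a matrix on `m + 1` qubits as a 2 × 2 matrix of
blocks, the form in which all products with first-qubit operators are computed. -/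
theorem sum_cons {m : ℕ} (f : (Fin (m + 1) → Fin 2) → ℂ) :
    ∑ x, f x = ∑ a : Fin 2, ∑ y : Fin m → Fin 2, f (Fin.cons a y) := by
  rw [← (Fin.consEquiv fun _ => Fin 2).sum_comp, Fintype.sum_prod_type]
  rfl

theorem ext_cons {m : ℕ} {A B : QMatrix (m + 1)}
    (h : ∀ a b x y, A (Fin.cons a x) (Fin.cons b y) = B (Fin.cons a x) (Fin.cons b y)) :
    A = B := by
  ext x y
  rw [← Fin.cons_self_tail x, ← Fin.cons_self_tail y]
  exact h _ _ _ _

theorem idTensor_mul {m : ℕ} (U V : QMatrix m) :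
    idTensor (U * V) = idTensor U * idTensor V := by
  refine ext_cons fun a b x y => ?_
  rw [Matrix.mul_apply, sum_cons]
  simp only [idTensor_apply_cons, Matrix.mul_apply]
  rw [Finset.sum_eq_single a]
  · simp only [if_true]
    split_ifs <;> simp
  · intro c _ hc
    simp [hc.symm]
  · simp

theorem idTensor_smul {m : ℕ} (c : ℂ) (U : QMatrix m) : idTensor (c • U) = c • idTensor U := by
  refine ext_cons fun a b x y => ?_
  simp [idTensor_apply_cons]

theorem idTensor_one {m : ℕ} : idTensor (1 : QMatrix m) = 1 := by
  refine ext_cons fun a b x y => ?_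
  simp only [idTensor_apply_cons, Matrix.one_apply, Fin.cons_inj]
  by_cases h : a = b <;> simp [h]

theorem idTensor_star {m : ℕ} (U : QMatrix m) : star (idTensor U) = idTensor (star U) := by
  refine ext_cons fun a b x y => ?_
  rw [Matrix.star_apply, idTensor_apply_cons, idTensor_apply_cons, Matrix.star_apply]
  by_cases h : a = b
  · simp [h]
  · simp [h, Ne.symm h]

theorem idTensor_injective {m : ℕ} : Function.Injective (idTensor : QMatrix m → QMatrix (m + 1)) := by
  intro U V h
  ext x y
  have := congr_fun (congr_fun h (Fin.cons 0 x)) (Fin.cons 0 y)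
  simpa [idTensor_apply_cons] using this

/-- The embedding `U ↦ I ⊗ U` of unitary groups. -/
noncomputable def idTensorHom (m : ℕ) : QUnitary m →* QUnitary (m + 1) where
  toFun U := ⟨idTensor U, by
    rw [Matrix.mem_unitaryGroup_iff, idTensor_star, ← idTensor_mul,
      Matrix.mem_unitaryGroup_iff.mp U.2, idTensor_one]⟩
  map_one' := Subtype.ext idTensor_one
  map_mul' U V := Subtype.ext (idTensor_mul _ _)

theorem idTensorHom_val {m : ℕ} (U : QUnitary m) :
    ((idTensorHom m U : QUnitary (m + 1)) : QMatrix (m + 1)) = idTensor (U : QMatrix m) := rfl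

theorem onQubit_zero_apply_cons {m : ℕ} (A : Matrix (Fin 2) (Fin 2) ℂ) (a b : Fin 2)
    (x y : Fin m → Fin 2) :
    onQubit 0 A (Fin.cons a x) (Fin.cons b y) = if x = y then A a b else 0 := by
  rw [onQubit_apply]
  congr 1
  simp [Fin.forall_fin_succ, funext_iff]

theorem onQubit_zero_mul_apply {m : ℕ} (A : Matrix (Fin 2) (Fin 2) ℂ) (W : QMatrix (m + 1))
    (a b : Fin 2) (x y : Fin m → Fin 2) :
    (onQubit 0 A * W : QMatrix (m + 1)) (Fin.cons a x) (Fin.cons b y) =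
      ∑ c, A a c * W (Fin.cons c x) (Fin.cons b y) := by
  rw [Matrix.mul_apply, sum_cons]
  simp [onQubit_zero_apply_cons]

theorem mul_onQubit_zero_apply {m : ℕ} (A : Matrix (Fin 2) (Fin 2) ℂ) (W : QMatrix (m + 1))
    (a b : Fin 2) (x y : Fin m → Fin 2) :
    (W * onQubit 0 A : QMatrix (m + 1)) (Fin.cons a x) (Fin.cons b y) =
      ∑ c, W (Fin.cons a x) (Fin.cons c y) * A c b := by
  rw [Matrix.mul_apply, sum_cons]
  simp [onQubit_zero_apply_cons]

theorem gateOn_zero_comm_idTensorHom {m : ℕ} (u : Matrix.unitaryGroup (Fin 2) ℂ)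
    (V : QUnitary m) : Commute (gateOn 0 u) (idTensorHom m V) := by
  apply Subtype.ext
  change onQubit 0 _ * idTensor _ = idTensor _ * onQubit 0 _
  refine ext_cons fun a b x y => ?_
  rw [onQubit_zero_mul_apply, mul_onQubit_zero_apply]
  simp [idTensor_apply_cons, mul_comm]

/-- The commutant of the Pauli matrices on the first qubit. -/
theorem exists_idTensorHom_eq {m : ℕ} (W : QUnitary (m + 1))
    (hX : W * gateOn 0 matX = gateOn 0 matX * W) (hZ : W * gateOn 0 matZ = gateOn 0 matZ * W) :
    ∃ V, idTensorHom m V = W := by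
  have hX' : W.1 * onQubit 0 matX.1 = onQubit 0 matX.1 * W.1 :=
    congrArg Subtype.val hX
  have hZ' : W.1 * onQubit 0 matZ.1 = onQubit 0 matZ.1 * W.1 :=
    congrArg Subtype.val hZ
  have eX := fun a b x y => congr_fun (congr_fun hX' (Fin.cons a x)) (Fin.cons b y)
  have eZ := fun a b x y => congr_fun (congr_fun hZ' (Fin.cons a x)) (Fin.cons b y)
  simp only [onQubit_zero_mul_apply, mul_onQubit_zero_apply, Fin.sum_univ_two] at eX eZ
  have key : idTensor (Matrix.of fun x y =>
      (W : QMatrix (m + 1)) (Fin.cons 0 x) (Fin.cons 0 y)) = W := by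
    refine ext_cons fun a b x y => ?_
    -- In blocks, the (0,1) entry of `WX = XW` says `W₀₀ = W₁₁`; the off-diagonal entries of `WZ =
    -- ZW` say `W₀₁ = -W₀₁` and `W₁₀ = -W₁₀`, so both vanish.
    have hx := eX 0 1 x y
    have hz := eZ 0 1 x y
    have hz' := eZ 1 0 x y
    simp [matX] at hx
    simp [matZ] at hz hz'
    rw [idTensor_apply_cons]
    fin_cases a <;> fin_cases b <;> simp
    · linear_combination hz / 2
    · linear_combination -hz' / 2
    · exact hx
  refine ⟨⟨_, ?_⟩, Subtype.ext key⟩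
  rw [Matrix.mem_unitaryGroup_iff]
  apply idTensor_injective
  rw [idTensor_mul, ← idTensor_star, key, idTensor_one]
  exact Matrix.mem_unitaryGroup_iff.mp W.2

theorem idTensorHom_gateOn {m : ℕ} (i : Fin m) (u : Matrix.unitaryGroup (Fin 2) ℂ) :
    idTensorHom m (gateOn i u) = gateOn i.succ u := by
  apply Subtype.ext
  change idTensor (onQubit i _) = onQubit i.succ _
  refine ext_cons fun a b x y => ?_
  rw [idTensor_apply_cons, onQubit_apply, onQubit_apply]
  by_cases h : a = b <;> simp [h, Fin.forall_fin_succ, (Fin.succ_ne_zero i).symm]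

theorem idTensorHom_gateCZ {m : ℕ} (i : Fin m) :
    idTensorHom (m + 1) (gateCZ i) = gateCZ i.succ := by
  apply Subtype.ext
  change idTensor (Matrix.diagonal _) = Matrix.diagonal _
  refine ext_cons fun a b x y => ?_
  simp only [idTensor_apply_cons, Matrix.diagonal_apply, Fin.cons_inj]
  by_cases h : a = b <;> simp [h]

theorem idTensorHom_scalarI {ω : ℂ} (hω : IsPrimitiveRoot ω 8) (m : ℕ) :
    idTensorHom m (scalarI hω m) = scalarI hω (m + 1) := by
  apply Subtype.ext
  change idTensor (_ • 1) = _ • 1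
  rw [idTensor_smul, idTensor_one]

/-- `U ↦ I ⊗ ⋯ ⊗ U ⊗ ⋯ ⊗ I` as a homomorphism. -/
noncomputable def gateOnHom {n : ℕ} (i : Fin n) :
    Matrix.unitaryGroup (Fin 2) ℂ →* QUnitary n where
  toFun := gateOn i
  map_one' := gateOn_one i
  map_mul' U V := (gateOn_mul i U V).symm

/-! ### Pauli and Clifford operators of the form `I ⊗ U` -/

theorem pauliGroup_le_iff {ω : ℂ} (hω : IsPrimitiveRoot ω 8) {n : ℕ}
    (K : Subgroup (QUnitary n)) :
    pauliGroup hω n ≤ K ↔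
      (∀ i, gateOn i matX ∈ K) ∧ (∀ i, gateOn i matZ ∈ K) ∧ scalarI hω n ∈ K := by
  rw [pauliGroup, Subgroup.closure_le, Set.union_subset_iff, Set.union_subset_iff,
    Set.range_subset_iff, Set.range_subset_iff, Set.singleton_subset_iff, and_assoc]
  rfl

theorem idTensorHom_mem_pauliGroup {ω : ℂ} (hω : IsPrimitiveRoot ω 8) {m : ℕ} {P : QUnitary m}
    (hP : P ∈ pauliGroup hω m) : idTensorHom m P ∈ pauliGroup hω (m + 1) := by
  have h : pauliGroup hω m ≤ (pauliGroup hω (m + 1)).comap (idTensorHom m) := by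
    rw [pauliGroup_le_iff]
    refine ⟨fun i => ?_, fun i => ?_, ?_⟩
    · rw [Subgroup.mem_comap, idTensorHom_gateOn]
      exact X_mem hω _
    · rw [Subgroup.mem_comap, idTensorHom_gateOn]
      exact Z_mem hω _
    · rw [Subgroup.mem_comap, idTensorHom_scalarI]
      exact scalarI_mem hω _
  exact h hP

/-- The one-qubit Pauli matrices are `±1`, `±X`, `±Z` and `±XZ`. -/
theorem oneQubit_pauli_cases {u : Matrix.unitaryGroup (Fin 2) ℂ}
    (hu : u ∈ Subgroup.closure {matX, matZ}) :
    ∃ v ∈ ({1, matX, matZ, matX * matZ} : Set (Matrix.unitaryGroup (Fin 2) ℂ)),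
      (u : Matrix (Fin 2) (Fin 2) ℂ) = v ∨ (u : Matrix (Fin 2) (Fin 2) ℂ) = -v := by
  have hX : (matX.1 * matX.1 : Matrix (Fin 2) (Fin 2) ℂ) = 1 := by
    ext i j; fin_cases i <;> fin_cases j <;> simp [matX]
  have hZ : (matZ.1 * matZ.1 : Matrix (Fin 2) (Fin 2) ℂ) = 1 := by
    ext i j; fin_cases i <;> fin_cases j <;> simp [matZ]
  have hZX : (matZ.1 * matX.1 : Matrix (Fin 2) (Fin 2) ℂ) = -(matX.1 * matZ.1) := by
    ext i j; fin_cases i <;> fin_cases j <;> simp [matZ, matX]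
  have hXX : matX * matX = 1 := Subtype.ext hX
  have hZZ : matZ * matZ = 1 := Subtype.ext hZ
  -- Left multiplication by a generator permutes the four representatives up to sign. Only `Z` can
  -- produce a sign, because `X` stands first in `X * Z`.
  have step : ∀ v ∈ ({1, matX, matZ, matX * matZ} : Set (Matrix.unitaryGroup (Fin 2) ℂ)),
      (∃ w ∈ ({1, matX, matZ, matX * matZ} : Set (Matrix.unitaryGroup (Fin 2) ℂ)),
        matX.1 * v.1 = w.1) ∧
      ∃ w ∈ ({1, matX, matZ, matX * matZ} : Set (Matrix.unitaryGroup (Fin 2) ℂ)),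
        matZ.1 * v.1 = w.1 ∨ matZ.1 * v.1 = -w.1 := by
    rintro v (rfl | rfl | rfl | rfl)
    · exact ⟨⟨matX, by simp, by simp⟩, ⟨matZ, by simp, by simp⟩⟩
    · exact ⟨⟨1, by simp, hX⟩, ⟨matX * matZ, by simp, Or.inr hZX⟩⟩
    · exact ⟨⟨matX * matZ, by simp, rfl⟩, ⟨1, by simp, Or.inl hZ⟩⟩
    · refine ⟨⟨matZ, by simp, ?_⟩, ⟨matX, by simp, Or.inr ?_⟩⟩
      · change matX.1 * (matX.1 * matZ.1) = _
        rw [← mul_assoc, hX, one_mul]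
      · change matZ.1 * (matX.1 * matZ.1) = _
        rw [← mul_assoc, hZX, neg_mul, mul_assoc, hZ, mul_one]
  have key : ∀ x ∈ ({matX, matZ} : Set (Matrix.unitaryGroup (Fin 2) ℂ)),
      ∀ y : Matrix.unitaryGroup (Fin 2) ℂ,
      (∃ v ∈ ({1, matX, matZ, matX * matZ} : Set (Matrix.unitaryGroup (Fin 2) ℂ)),
        (y : Matrix (Fin 2) (Fin 2) ℂ) = v ∨ (y : Matrix (Fin 2) (Fin 2) ℂ) = -v) →
      ∃ v ∈ ({1, matX, matZ, matX * matZ} : Set (Matrix.unitaryGroup (Fin 2) ℂ)),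
        x.1 * y.1 = v.1 ∨ x.1 * y.1 = -v.1 := by
    rintro x hx y ⟨v, hv, hy⟩
    obtain ⟨⟨w, hw, h1⟩, ⟨w', hw', h2⟩⟩ := step v hv
    rcases hx with rfl | rfl
    · refine ⟨w, hw, ?_⟩
      rcases hy with hy | hy
      · left; rw [hy, h1]
      · right; rw [hy, mul_neg, h1]
    · refine ⟨w', hw', ?_⟩
      rcases hy with hy | hy
      · rw [hy]; exact h2
      · rw [hy, mul_neg, neg_inj]
        rcases h2 with h2 | h2
        · exact Or.inr h2
        · left; rw [h2, neg_neg]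
  induction hu using Subgroup.closure_induction_left with
  | one => exact ⟨1, by simp, by simp⟩
  | mul_left x hx y hy ih => exact key x hx y ih
  | inv_mul_cancel x hx y hy ih =>
    -- Both generators are involutions, so the inverse case repeats the previous one.
    have : x⁻¹ = x := by
      rcases hx with rfl | rfl
      · exact inv_eq_of_mul_eq_one_left hXX
      · exact inv_eq_of_mul_eq_one_left hZZ
    rw [this]
    exact key x hx y ih

/-- Every Pauli operator is the product of one on the first qubit and one on the others. -/
theorem exists_pauli_decomp {ω : ℂ} (hω : IsPrimitiveRoot ω 8) {m : ℕ} {P : QUnitary (m + 1)}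
    (hP : P ∈ pauliGroup hω (m + 1)) :
    ∃ u ∈ Subgroup.closure {matX, matZ}, ∃ Q ∈ pauliGroup hω m,
      P = gateOn 0 u * idTensorHom m Q := by
  -- Such products form a subgroup because the two factors commute; it then suffices to look at the
  -- generators.
  have h : pauliGroup hω (m + 1) ≤
      { carrier := {P | ∃ u ∈ Subgroup.closure {matX, matZ}, ∃ Q ∈ pauliGroup hω m,
          P = gateOn 0 u * idTensorHom m Q}
        one_mem' := ⟨1, one_mem _, 1, one_mem _, by rw [gateOn_one, map_one, one_mul]⟩
        mul_mem' := by
          rintro _ _ ⟨u, hu, Q, hQ, rfl⟩ ⟨v, hv, R, hR, rfl⟩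
          refine ⟨u * v, mul_mem hu hv, Q * R, mul_mem hQ hR, ?_⟩
          rw [map_mul, ← gateOn_mul]
          exact ((gateOn_zero_comm_idTensorHom v Q).symm.mul_mul_mul_comm _ _)
        inv_mem' := by
          rintro _ ⟨u, hu, Q, hQ, rfl⟩
          refine ⟨u⁻¹, inv_mem hu, Q⁻¹, inv_mem hQ, ?_⟩
          rw [(gateOn_zero_comm_idTensorHom u Q).eq, _root_.mul_inv_rev, map_inv]
          congr 1
          exact (map_inv (gateOnHom 0) u).symm } := by
    rw [pauliGroup_le_iff]
    refine ⟨fun i => ?_, fun i => ?_, ?_⟩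
    · refine Fin.cases ?_ (fun i => ?_) i
      · exact ⟨matX, Subgroup.subset_closure (by simp), 1, one_mem _, by rw [map_one, mul_one]⟩
      · exact ⟨1, one_mem _, _, X_mem hω i, by rw [gateOn_one, idTensorHom_gateOn, one_mul]⟩
    · refine Fin.cases ?_ (fun i => ?_) i
      · exact ⟨matZ, Subgroup.subset_closure (by simp), 1, one_mem _, by rw [map_one, mul_one]⟩
      · exact ⟨1, one_mem _, _, Z_mem hω i, by rw [gateOn_one, idTensorHom_gateOn, one_mul]⟩
    -- The phase `ω²` goes into the second factor, so `u` ranges over a group whose only scalars are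
    -- `±1`.
    · exact ⟨1, one_mem _, _, scalarI_mem hω m, by rw [gateOn_one, idTensorHom_scalarI, one_mul]⟩
  exact h hP

/-- If `I ⊗ P = u ⊗ Q` with `Q` Pauli, then `u` is scalar, hence `±1`, so `P = ±Q`; and `-1 = (ω²)²`
is itself a Pauli phase. -/
theorem mem_pauliGroup_of_idTensorHom_mem {ω : ℂ} (hω : IsPrimitiveRoot ω 8) {m : ℕ}
    {P : QUnitary m} (hP : idTensorHom m P ∈ pauliGroup hω (m + 1)) : P ∈ pauliGroup hω m := by
  obtain ⟨u, hu, Q, hQ, e⟩ := exists_pauli_decomp hω hP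
  have e' : idTensorHom m (P * Q⁻¹) = gateOn 0 u := by rw [map_mul, e, map_inv]; group
  have ee : ∀ a b x y, idTensor (P * Q⁻¹).1 (Fin.cons a x) (Fin.cons b y) =
      onQubit 0 u.1 (Fin.cons a x) (Fin.cons b y) := fun a b x y =>
    congr_fun (congr_fun (congrArg Subtype.val e') _) _
  simp only [idTensor_apply_cons, onQubit_zero_apply_cons] at ee
  have h2 : scalarI hω m ^ 2 ∈ pauliGroup hω m := pow_mem (scalarI_mem hω m) 2
  have h2v : (scalarI hω m ^ 2).1 = -1 := by
    change ((ω ^ 2) • (1 : QMatrix m)) ^ 2 = -1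
    rw [smul_pow, one_pow, ← pow_mul, root_pow_four hω, neg_smul, one_smul]
  have h3 : P * Q⁻¹ ∈ pauliGroup hω m := by
    obtain ⟨v, hv, huv⟩ := oneQubit_pauli_cases hu
    -- The vanishing of `u₀₁` excludes `X` and `XZ`, and `u₀₀ = u₁₁` excludes `Z`.
    have hv00 : u.1 0 0 = 1 ∨ u.1 0 0 = -1 := by
      have e01 := ee 0 1 (fun _ => 0) (fun _ => 0)
      have e11 := ee 1 1 (fun _ => 0) (fun _ => 0)
      have e0 := ee 0 0 (fun _ => 0) (fun _ => 0)
      simp at e01 e11 e0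
      have e3 := e0.symm.trans e11
      rcases hv with rfl | rfl | rfl | rfl <;> rcases huv with h | h <;> rw [h] at e01 e3 ⊢ <;>
        simp [matX, matZ] at e01 e3 ⊢
    have hs : (P * Q⁻¹).1 = u.1 0 0 • (1 : QMatrix m) := by
      ext x y
      have := ee 0 0 x y
      simpa [Matrix.one_apply] using this
    rcases hv00 with h | h
    · have : P * Q⁻¹ = 1 := Subtype.ext (by rw [hs, h, one_smul]; rfl)
      rw [this]; exact one_mem _
    · have : P * Q⁻¹ = scalarI hω m ^ 2 := Subtype.ext (by rw [hs, h, neg_smul, one_smul, h2v])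
      rw [this]; exact h2
  simpa using mul_mem h3 hQ

/-- The smaller Pauli group is the full preimage of the larger one under the embedding, so
normalizing pulls back. -/
theorem mem_cliffordGroup_of_idTensorHom_mem {ω : ℂ} (hω : IsPrimitiveRoot ω 8) {m : ℕ}
    {U : QUnitary m} (hU : idTensorHom m U ∈ cliffordGroup hω (m + 1)) :
    U ∈ cliffordGroup hω m := by
  rw [cliffordGroup, Subgroup.mem_normalizer_iff] at hU ⊢
  intro P
  have h : ∀ P : QUnitary m, idTensorHom m P ∈ pauliGroup hω (m + 1) ↔ P ∈ pauliGroup hω m :=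
    fun P => ⟨mem_pauliGroup_of_idTensorHom_mem hω, idTensorHom_mem_pauliGroup hω⟩
  have := hU (idTensorHom m P)
  rw [← map_inv, ← map_mul, ← map_mul] at this
  rw [← h P, ← h]
  exact this

/-- Conjugation by `I ⊗ U` fixes the generators on the first qubit and acts as `U` on the others;
the reverse inclusion comes from `U⁻¹`. -/
theorem idTensorHom_mem_cliffordGroup {ω : ℂ} (hω : IsPrimitiveRoot ω 8) {m : ℕ}
    {U : QUnitary m} (hU : U ∈ cliffordGroup hω m) :
    idTensorHom m U ∈ cliffordGroup hω (m + 1) := by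
  have key : ∀ U ∈ cliffordGroup hω m, ∀ P ∈ pauliGroup hω (m + 1),
      idTensorHom m U * P * (idTensorHom m U)⁻¹ ∈ pauliGroup hω (m + 1) := by
    intro U hU P hP
    have h : ∀ Q ∈ pauliGroup hω m, idTensorHom m U * idTensorHom m Q * (idTensorHom m U)⁻¹ ∈
        pauliGroup hω (m + 1) := by
      intro Q hQ
      rw [← map_inv, ← map_mul, ← map_mul]
      exact idTensorHom_mem_pauliGroup hω ((Subgroup.mem_normalizer_iff.mp hU Q).mp hQ)
    have h0 : ∀ u, gateOn 0 u ∈ pauliGroup hω (m + 1) →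
        idTensorHom m U * gateOn 0 u * (idTensorHom m U)⁻¹ ∈ pauliGroup hω (m + 1) := by
      intro u hu
      rwa [← (gateOn_zero_comm_idTensorHom u U).eq, mul_inv_cancel_right]
    have hle : pauliGroup hω (m + 1) ≤
        (pauliGroup hω (m + 1)).comap (MulAut.conj (idTensorHom m U)).toMonoidHom := by
      rw [pauliGroup_le_iff]
      refine ⟨fun i => ?_, fun i => ?_, ?_⟩
      · refine Fin.cases (h0 _ (X_mem hω 0)) (fun i => ?_) i
        rw [← idTensorHom_gateOn]
        exact h _ (X_mem hω i)
      · refine Fin.cases (h0 _ (Z_mem hω 0)) (fun i => ?_) i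
        rw [← idTensorHom_gateOn]
        exact h _ (Z_mem hω i)
      · rw [← idTensorHom_scalarI]
        exact h _ (scalarI_mem hω m)
    exact hle hP
  rw [cliffordGroup, Subgroup.mem_normalizer_iff]
  refine fun P => ⟨key U hU P, fun hP => ?_⟩
  have := key _ (inv_mem hU) _ hP
  simpa [mul_assoc] using this

/-! ### Conjugation up to a phase -/

/-- `g` conjugates `A` to a multiple of `B`. -/
def PhaseConj {n : ℕ} (g A B : QUnitary n) : Prop :=
  ∃ c : ℂ, g.1 * A.1 = c • (B.1 * g.1)

theorem PhaseConj.of_eq {n : ℕ} {g A B : QUnitary n} (h : g * A = B * g) : PhaseConj g A B :=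
  ⟨1, by rw [one_smul]; exact congrArg Subtype.val h⟩

theorem PhaseConj.comp {n : ℕ} {g h A B C : QUnitary n} (hh : PhaseConj h B C)
    (hg : PhaseConj g A B) : PhaseConj (h * g) A C := by
  obtain ⟨c, hc⟩ := hg
  obtain ⟨d, hd⟩ := hh
  refine ⟨c * d, ?_⟩
  change h.1 * g.1 * A.1 = (c * d) • (C.1 * (h.1 * g.1))
  rw [mul_assoc, hc, mul_smul_comm, ← mul_assoc, hd, smul_mul_assoc, smul_smul, mul_assoc]

theorem PhaseConj.mul {n : ℕ} {g A B A' B' : QUnitary n} (h : PhaseConj g A B)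
    (h' : PhaseConj g A' B') : PhaseConj g (A * A') (B * B') := by
  obtain ⟨c, hc⟩ := h
  obtain ⟨d, hd⟩ := h'
  refine ⟨c * d, ?_⟩
  change g.1 * (A.1 * A'.1) = (c * d) • (B.1 * B'.1 * g.1)
  rw [← mul_assoc, hc, smul_mul_assoc, mul_assoc, hd, mul_smul_comm, smul_smul, mul_assoc]

theorem PhaseConj.idTensorHom {m : ℕ} {g A B : QUnitary m} (h : PhaseConj g A B) :
    PhaseConj (idTensorHom m g) (idTensorHom m A) (idTensorHom m B) := by
  obtain ⟨c, hc⟩ := h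
  refine ⟨c, ?_⟩
  simp only [idTensorHom_val]
  rw [← idTensor_mul, hc, idTensor_smul, idTensor_mul]

theorem PhaseConj.gateOn {n : ℕ} (i : Fin n) {g A B : Matrix.unitaryGroup (Fin 2) ℂ} {c : ℂ}
    (h : g.1 * A.1 = c • (B.1 * g.1)) :
    PhaseConj (gateOn i g) (gateOn i A) (gateOn i B) := by
  refine ⟨c, ?_⟩
  change onQubit i _ * onQubit i _ = c • (onQubit i _ * onQubit i _)
  rw [onQubit_mul, onQubit_mul, h, onQubit_smul]

/-- Moving `A` past `g` twice gives `g = c² g`, so the phase is a sign. -/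
theorem PhaseConj.eq_or_eq_neg {n : ℕ} {g A : QUnitary n} (hA : A * A = 1)
    (h : PhaseConj g A A) : g * A = A * g ∨ g.1 * A.1 = -(A.1 * g.1) := by
  obtain ⟨c, hc⟩ := h
  have hA' : A.1 * A.1 = 1 := congrArg Subtype.val hA
  have e : g.1 = (c * c) • g.1 := by
    calc g.1 = g.1 * A.1 * A.1 := by rw [mul_assoc, hA', mul_one]
      _ = (c * c) • (A.1 * A.1 * g.1) := by
        rw [hc, smul_mul_assoc, mul_assoc, hc, mul_smul_comm, smul_smul, mul_assoc]
      _ = _ := by rw [hA', one_mul]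
  have hg : g.1 * star g.1 = 1 := Matrix.mem_unitaryGroup_iff.mp g.2
  have e1 : (1 : QMatrix n) = (c * c) • 1 := by
    calc (1 : QMatrix n) = g.1 * star g.1 := hg.symm
      _ = ((c * c) • g.1) * star g.1 := by rw [← e]
      _ = _ := by rw [smul_mul_assoc, hg]
  have e2 := congr_fun (congr_fun e1 (fun _ => 0)) (fun _ => 0)
  simp only [Matrix.one_apply_eq, Matrix.smul_apply, smul_eq_mul, mul_one] at e2
  rcases mul_self_eq_one_iff.mp e2.symm with h | h
  · left
    apply Subtype.ext
    change g.1 * A.1 = A.1 * g.1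
    rw [hc, h, one_smul]
  · right
    rw [hc, h, neg_smul, one_smul]

/-! ### The group generated by the gates -/

/-- The group generated by the Hadamard, phase and controlled `Z` gates on `m + 1` qubits. -/
def gateGroup {ω : ℂ} (hω : IsPrimitiveRoot ω 8) (m : ℕ) : Subgroup (QUnitary (m + 1)) :=
  Subgroup.closure (Set.range (fun i => gateOn i matH) ∪
    Set.range (fun i => gateOn i (matS hω)) ∪ Set.range gateCZ)

theorem gateOn_H_mem {ω : ℂ} (hω : IsPrimitiveRoot ω 8) {m : ℕ} (i : Fin (m + 1)) :
    gateOn i matH ∈ gateGroup hω m :=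
  Subgroup.subset_closure (Or.inl (Or.inl ⟨i, rfl⟩))

theorem gateOn_S_mem {ω : ℂ} (hω : IsPrimitiveRoot ω 8) {m : ℕ} (i : Fin (m + 1)) :
    gateOn i (matS hω) ∈ gateGroup hω m :=
  Subgroup.subset_closure (Or.inl (Or.inr ⟨i, rfl⟩))

theorem gateCZ_mem_gateGroup {ω : ℂ} (hω : IsPrimitiveRoot ω 8) {m : ℕ} (i : Fin m) :
    gateCZ i ∈ gateGroup hω m :=
  Subgroup.subset_closure (Or.inr ⟨i, rfl⟩)

theorem gateGroup_le_iff {ω : ℂ} (hω : IsPrimitiveRoot ω 8) {m : ℕ}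
    (K : Subgroup (QUnitary (m + 1))) :
    gateGroup hω m ≤ K ↔ (∀ i, gateOn i matH ∈ K) ∧ (∀ i, gateOn i (matS hω) ∈ K) ∧
      ∀ i, gateCZ i ∈ K := by
  rw [gateGroup, Subgroup.closure_le, Set.union_subset_iff, Set.union_subset_iff,
    Set.range_subset_iff, Set.range_subset_iff, Set.range_subset_iff, and_assoc]
  rfl

theorem gateGroup_le_cliffordGroup {ω : ℂ} (hω : IsPrimitiveRoot ω 8) (m : ℕ) :
    gateGroup hω m ≤ cliffordGroup hω (m + 1) := by
  rw [gateGroup_le_iff]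
  exact ⟨gateH_mem hω, gateS_mem hω, gateCZ_mem hω⟩

theorem idTensorHom_mem_gateGroup {ω : ℂ} (hω : IsPrimitiveRoot ω 8) {m : ℕ}
    {g : QUnitary (m + 1)} (hg : g ∈ gateGroup hω m) :
    idTensorHom (m + 1) g ∈ gateGroup hω (m + 1) := by
  have h : gateGroup hω m ≤ (gateGroup hω (m + 1)).comap (idTensorHom (m + 1)) := by
    rw [gateGroup_le_iff]
    refine ⟨fun i => ?_, fun i => ?_, fun i => ?_⟩
    · rw [Subgroup.mem_comap, idTensorHom_gateOn]
      exact gateOn_H_mem hω _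
    · rw [Subgroup.mem_comap, idTensorHom_gateOn]
      exact gateOn_S_mem hω _
    · rw [Subgroup.mem_comap, idTensorHom_gateCZ]
      exact gateCZ_mem_gateGroup hω _
  exact h hg

theorem gateOn_mem_gateGroup {ω : ℂ} (hω : IsPrimitiveRoot ω 8) {m : ℕ} (i : Fin (m + 1))
    {u : Matrix.unitaryGroup (Fin 2) ℂ} (hu : u ∈ Subgroup.closure {matH, matS hω}) :
    gateOn i u ∈ gateGroup hω m := by
  have h : Subgroup.closure {matH, matS hω} ≤ (gateGroup hω m).comap (gateOnHom i) := by
    rw [Subgroup.closure_le]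
    rintro _ (rfl | rfl)
    · exact gateOn_H_mem hω i
    · exact gateOn_S_mem hω i
  exact h hu

/-! ### One-qubit Pauli matrices under conjugation by `H` and `S` -/

theorem matS_sq {ω : ℂ} (hω : IsPrimitiveRoot ω 8) : matS hω * matS hω = matZ := by
  have h := root_pow_four hω
  apply Subtype.ext
  ext i j
  fin_cases i <;> fin_cases j <;> simp [matS, matZ]
  linear_combination h

theorem matX_sq : matX * matX = 1 := by
  apply Subtype.ext
  ext i j
  fin_cases i <;> fin_cases j <;> simp [matX]

theorem matZ_sq : matZ * matZ = 1 := by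
  apply Subtype.ext
  ext i j
  fin_cases i <;> fin_cases j <;> simp [matZ]

theorem matZ_mul_matX :
    (matZ.1 * matX.1 : Matrix (Fin 2) (Fin 2) ℂ) = -(matX.1 * matZ.1) := by
  ext i j
  fin_cases i <;> fin_cases j <;> simp [matX, matZ]

theorem matH_matZ_matH : matH * matZ * matH = matX := by
  rw [matH_Z, mul_assoc, matH_sq, mul_one]

theorem matZ_mem_closure {ω : ℂ} (hω : IsPrimitiveRoot ω 8) :
    matZ ∈ Subgroup.closure {matH, matS hω} := by
  have hS : matS hω ∈ Subgroup.closure {matH, matS hω} := Subgroup.subset_closure (by simp)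
  rw [← matS_sq hω]
  exact mul_mem hS hS

theorem matX_mem_closure {ω : ℂ} (hω : IsPrimitiveRoot ω 8) :
    matX ∈ Subgroup.closure {matH, matS hω} := by
  have hH : matH ∈ Subgroup.closure {matH, matS hω} := Subgroup.subset_closure (by simp)
  rw [← matH_matZ_matH]
  exact mul_mem (mul_mem hH (matZ_mem_closure hω)) hH

/-- A one-qubit Pauli matrix not commuting with `X` is conjugate to `Z` by a matrix commuting
with `X`. -/
theorem exists_conj_matZ {ω : ℂ} (hω : IsPrimitiveRoot ω 8) {u : Matrix.unitaryGroup (Fin 2) ℂ}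
    (hu : u ∈ Subgroup.closure {matX, matZ}) (hc : matX * u ≠ u * matX) :
    ∃ g ∈ Subgroup.closure {matH, matS hω}, g * matX = matX * g ∧
      ∃ c : ℂ, g.1 * u.1 = c • (matZ.1 * g.1) := by
  have hH : matH ∈ Subgroup.closure {matH, matS hω} := Subgroup.subset_closure (by simp)
  have hS : matS hω ∈ Subgroup.closure {matH, matS hω} := Subgroup.subset_closure (by simp)
  -- `HSH` squares to `HZH = X`. It fixes `X` under conjugation and sends `XZ` to a multiple of `Z`,
  -- which makes it the witness in the only nontrivial case.
  have hHSH : matH * matS hω * matH * matX = matX * (matH * matS hω * matH) := by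
    calc _ = matH * matS hω * (matH * matX) := by group
      _ = matH * (matS hω * matZ) * matH := by rw [matH_X]; group
      _ = matH * matZ * matS hω * matH := by rw [matS_Z]; group
      _ = _ := by rw [matH_Z]; group
  have hHSHXZ : (matH * matS hω * matH).1 * (matX * matZ).1 =
      (-ω ^ 2) • (matZ.1 * (matH * matS hω * matH).1) := by
    have e1 : matH * matS hω * matH * (matX * matZ) =
        matX * matH * (matS hω * matX) * matH := by
      calc _ = matH * matS hω * matH * matX * matZ := by group
        _ = matX * matH * matS hω * (matH * matZ) := by rw [hHSH]; group
        _ = _ := by rw [matH_Z]; group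
    have e2 : matX * matH * (matX * matZ * matS hω) * matH =
        matX * (matZ * matX) * (matH * matS hω * matH) := by
      calc _ = matX * (matH * matX) * matZ * matS hω * matH := by group
        _ = matX * matZ * (matH * matZ) * matS hω * matH := by rw [matH_X]; group
        _ = _ := by rw [matH_Z]; group
    have hXX : matX.1 * matX.1 = 1 := congrArg Subtype.val matX_sq
    calc _ = matX.1 * matH.1 * (matS hω * matX).1 * matH.1 := congrArg Subtype.val e1
      _ = ω ^ 2 • (matX * matH * (matX * matZ * matS hω) * matH).1 := by
        rw [matS_X, mul_smul_comm, smul_mul_assoc]; rfl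
      _ = ω ^ 2 • (matX.1 * (matZ.1 * matX.1) * (matH * matS hω * matH).1) := by rw [e2]; rfl
      _ = _ := by
        rw [matZ_mul_matX, mul_neg, ← mul_assoc, hXX, one_mul, neg_mul, smul_neg, neg_smul]
  obtain ⟨v, hv, h⟩ := oneQubit_pauli_cases hu
  have hcv : matX * v ≠ v * matX := by
    intro e
    have e' : matX.1 * v.1 = v.1 * matX.1 := congrArg Subtype.val e
    apply hc
    apply Subtype.ext
    change matX.1 * u.1 = u.1 * matX.1
    rcases h with h | h <;> rw [h]
    · exact e'
    · rw [mul_neg, neg_mul, e']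
  suffices ∃ g ∈ Subgroup.closure {matH, matS hω}, g * matX = matX * g ∧
      ∃ c : ℂ, g.1 * v.1 = c • (matZ.1 * g.1) by
    obtain ⟨g, hg, hgX, c, hgc⟩ := this
    rcases h with h | h
    · exact ⟨g, hg, hgX, c, by rw [h, hgc]⟩
    · exact ⟨g, hg, hgX, -c, by rw [h, mul_neg, hgc, neg_smul]⟩
  -- Failure to commute with `X` leaves only `Z`, already in place, and `XZ`.
  rcases hv with rfl | rfl | rfl | rfl
  · simp at hcv
  · simp at hcv
  · exact ⟨1, one_mem _, by simp, 1, by simp⟩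
  · exact ⟨_, mul_mem (mul_mem hH hS) hH, hHSH, _, hHSHXZ⟩

/-- A nonscalar one-qubit Pauli matrix is conjugate to `X`. -/
theorem exists_conj_matX {ω : ℂ} (hω : IsPrimitiveRoot ω 8) {u : Matrix.unitaryGroup (Fin 2) ℂ}
    (hu : u ∈ Subgroup.closure {matX, matZ}) (hc : ∀ c : ℂ, u.1 ≠ c • 1) :
    ∃ g ∈ Subgroup.closure {matH, matS hω}, ∃ c : ℂ, g.1 * u.1 = c • (matX.1 * g.1) := by
  have hH : matH ∈ Subgroup.closure {matH, matS hω} := Subgroup.subset_closure (by simp)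
  -- A nonscalar `u` commuting with `X` is `±X`. Otherwise it can be taken to `Z`, and then `H`
  -- takes `Z` to `X`.
  by_cases hX : matX * u = u * matX
  · refine ⟨1, one_mem _, ?_⟩
    obtain ⟨v, hv, h⟩ := oneQubit_pauli_cases hu
    have hXv : matX.1 * v.1 = v.1 * matX.1 := by
      have e' : matX.1 * u.1 = u.1 * matX.1 := congrArg Subtype.val hX
      rcases h with h | h <;> rw [h] at e'
      · exact e'
      · simpa using e'
    rcases hv with rfl | rfl | rfl | rfl
    · rcases h with h | h
      · exact absurd (by rw [h, one_smul]; rfl) (hc 1)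
      · exact absurd (by rw [h, neg_smul, one_smul]; rfl) (hc (-1))
    · rcases h with h | h
      · exact ⟨1, by simp [h]⟩
      · exact ⟨-1, by simp [h]⟩
    · have := congr_fun (congr_fun hXv 0) 1
      norm_num [matX, matZ] at this
    · have := congr_fun (congr_fun hXv 0) 0
      norm_num [matX, matZ] at this
  · obtain ⟨g, hg, -, c, h⟩ := exists_conj_matZ hω hu hX
    refine ⟨matH * g, mul_mem hH hg, c, ?_⟩
    change matH.1 * g.1 * u.1 = c • (matX.1 * (matH.1 * g.1))
    have e : matH.1 * matZ.1 = matX.1 * matH.1 := congrArg Subtype.val matH_Z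
    rw [mul_assoc, h, mul_smul_comm, ← mul_assoc, e, mul_assoc]

/-! ### Transitivity on Pauli operators -/

theorem gateCZ_comm_Z {m : ℕ} (i : Fin m) (j : Fin (m + 1)) :
    PhaseConj (gateCZ i) (gateOn j matZ) (gateOn j matZ) :=
  .of_eq (gateCZ_Z i j)

theorem gateOn_Z_sq {n : ℕ} (i : Fin n) : gateOn i matZ * gateOn i matZ = 1 := by
  rw [gateOn_mul, matZ_sq, gateOn_one]

theorem gateOn_X_sq {n : ℕ} (i : Fin n) : gateOn i matX * gateOn i matX = 1 := by
  rw [gateOn_mul, matX_sq, gateOn_one]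

/-- The controlled `Z` gate maps `X_0 Z_1` to `X_0`. -/
theorem gateCZ_conj_XZ {m : ℕ} :
    PhaseConj (gateCZ (0 : Fin (m + 1))) (gateOn 0 matX * gateOn 1 matZ) (gateOn 0 matX) := by
  apply PhaseConj.of_eq
  have h := gateCZ_X_left (0 : Fin (m + 1))
  have h2 := gateCZ_Z (0 : Fin (m + 1)) 1
  simp only [Fin.castSucc_zero, Fin.succ_zero_eq_one] at h
  rw [← mul_assoc, h, mul_assoc, h2, mul_assoc, ← mul_assoc (gateOn 1 matZ), gateOn_Z_sq, one_mul]

/-- The Hadamard pair turns `Z_0 X_1` into `X_0 Z_1`, which `gateCZ_conj_XZ` reduces to `X_0`. -/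
theorem hadamards_conj {m : ℕ} (i j : Fin m) (hij : i ≠ j) :
    PhaseConj (gateOn i matH * gateOn j matH) (gateOn i matZ) (gateOn i matX) ∧
    PhaseConj (gateOn i matH * gateOn j matH) (gateOn i matX) (gateOn i matZ) ∧
    PhaseConj (gateOn i matH * gateOn j matH) (gateOn j matX) (gateOn j matZ) := by
  have hHZ : gateOn i matH * gateOn i matZ = gateOn i matX * gateOn i matH := by
    rw [gateOn_mul, matH_Z, gateOn_mul]
  have hHX : ∀ k : Fin m, gateOn k matH * gateOn k matX = gateOn k matZ * gateOn k matH :=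
    fun k => by rw [gateOn_mul, matH_X, gateOn_mul]
  exact ⟨(PhaseConj.of_eq hHZ).comp (.of_eq (gateOn_comm hij.symm _ _)),
    (PhaseConj.of_eq (hHX i)).comp (.of_eq (gateOn_comm hij.symm _ _)),
    (PhaseConj.of_eq (gateOn_comm hij _ _)).comp (.of_eq (hHX j))⟩

/-- A unitary that is a scalar matrix. -/
def IsPhase {n : ℕ} (P : QUnitary n) : Prop := ∃ c : ℂ, P.1 = c • (1 : QMatrix n)

/-- Operators on zero qubits are 1 × 1 matrices; this starts the inductions on the number of qubits.
-/
theorem isPhase_zero (P : QUnitary 0) : IsPhase P := by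
  refine ⟨P.1 Fin.elim0 Fin.elim0, ?_⟩
  ext x y
  rw [Subsingleton.elim x y, Subsingleton.elim y Fin.elim0]
  simp

theorem IsPhase.idTensorHom {m : ℕ} {P : QUnitary m} (h : IsPhase P) :
    IsPhase (idTensorHom m P) := by
  obtain ⟨c, hc⟩ := h
  exact ⟨c, by rw [idTensorHom_val, hc, idTensor_smul, idTensor_one]⟩

theorem IsPhase.phaseConj {n : ℕ} {P : QUnitary n} (h : IsPhase P) (g : QUnitary n) :
    PhaseConj g P 1 := by
  obtain ⟨c, hc⟩ := h
  exact ⟨c, by rw [hc]; simp⟩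

theorem PhaseConj.mul_isPhase {n : ℕ} {g A B P : QUnitary n} (h : PhaseConj g A B)
    (hP : IsPhase P) : PhaseConj g (A * P) B := by
  simpa using h.mul (hP.phaseConj g)

theorem gateOn_isPhase {n : ℕ} (i : Fin n) {u : Matrix.unitaryGroup (Fin 2) ℂ} {c : ℂ}
    (h : u.1 = c • 1) : IsPhase (gateOn i u) := by
  refine ⟨c, ?_⟩
  change onQubit i u.1 = _
  rw [h, onQubit_smul, onQubit_one]

theorem IsPhase.mul {n : ℕ} {P Q : QUnitary n} (hP : IsPhase P) (hQ : IsPhase Q) :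
    IsPhase (P * Q) := by
  obtain ⟨c, hc⟩ := hP
  obtain ⟨d, hd⟩ := hQ
  refine ⟨c * d, ?_⟩
  change P.1 * Q.1 = _
  rw [hc, hd, smul_mul_smul_comm, one_mul]

/-- Every nonscalar Pauli operator is conjugate to `X_0` up to a phase. -/
theorem exists_conj_X {ω : ℂ} (hω : IsPrimitiveRoot ω 8) (m : ℕ) :
    ∀ P ∈ pauliGroup hω (m + 1), ¬ IsPhase P →
      ∃ g ∈ gateGroup hω m, PhaseConj g P (gateOn 0 matX) := by
  have hlocal : ∀ (m : ℕ) (u) (_ : u ∈ Subgroup.closure {matX, matZ}) (Q : QUnitary m),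
      IsPhase Q → ¬ IsPhase (gateOn 0 u * idTensorHom m Q) →
      ∃ g ∈ gateGroup hω m,
        PhaseConj g (gateOn 0 u * idTensorHom m Q) (gateOn 0 matX) := by
    intro m u hu Q hQ hP
    obtain ⟨g, hg, c, h⟩ := exists_conj_matX hω hu
      fun c hc => hP ((gateOn_isPhase 0 hc).mul hQ.idTensorHom)
    exact ⟨_, gateOn_mem_gateGroup hω 0 hg, (PhaseConj.gateOn 0 h).mul_isPhase hQ.idTensorHom⟩
  induction m with
  | zero =>
    intro P hP hP'
    obtain ⟨u, hu, Q, -, rfl⟩ := exists_pauli_decomp hω hP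
    exact hlocal 0 u hu Q (isPhase_zero Q) hP'
  | succ m ih =>
    intro P hP hP'
    obtain ⟨u, hu, Q, hQ, rfl⟩ := exists_pauli_decomp hω hP
    by_cases hQ' : IsPhase Q
    · exact hlocal _ u hu Q hQ' hP'
    obtain ⟨g, hg, h⟩ := ih Q hQ hQ'
    have hH : matH ∈ Subgroup.closure {matH, matS hω} := Subgroup.subset_closure (by simp)
    have h1 := h.idTensorHom
    rw [idTensorHom_gateOn, Fin.succ_zero_eq_one] at h1
    -- With the tail reduced to `X_1`, the first factor is made into `Z`: a scalar `u` by the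
    -- controlled `Z`, which sends `X_1` to `X_1 Z_0`; a nonscalar `u` by passing to `X` and then
    -- applying `H`.
    have h2 : ∃ g ∈ gateGroup hω (m + 1), PhaseConj g (gateOn 0 u * gateOn 1 matX)
        (gateOn 0 matZ * gateOn 1 matX) := by
      by_cases hc : ∃ c : ℂ, u.1 = c • 1
      · obtain ⟨c, hc⟩ := hc
        refine ⟨_, gateCZ_mem_gateGroup hω 0, ?_⟩
        have h := gateCZ_X_right (0 : Fin (m + 1))
        simp only [Fin.castSucc_zero, Fin.succ_zero_eq_one] at h
        rw [gateOn_comm (Fin.zero_ne_one), gateOn_comm (Fin.zero_ne_one)]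
        exact (PhaseConj.of_eq h).mul_isPhase (gateOn_isPhase 0 hc)
      · push Not at hc
        obtain ⟨k, hk, c, h⟩ := exists_conj_matX hω hu hc
        refine ⟨_, gateOn_mem_gateGroup hω 0 (mul_mem hH hk), ?_⟩
        refine PhaseConj.mul ?_ (.of_eq (gateOn_comm Fin.zero_ne_one _ _))
        refine PhaseConj.gateOn (c := c) 0 ?_
        have e : matH.1 * matX.1 = matZ.1 * matH.1 := congrArg Subtype.val matH_X
        change matH.1 * k.1 * u.1 = c • (matZ.1 * (matH.1 * k.1))
        rw [mul_assoc, h, mul_smul_comm, ← mul_assoc, e, mul_assoc]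
    obtain ⟨k, hk, h2⟩ := h2
    -- The end of the route is `Z_0 X_1 ↦ X_0 Z_1 ↦ X_0`.
    obtain ⟨h3, -, h4⟩ := hadamards_conj (0 : Fin (m + 2)) 1 Fin.zero_ne_one
    exact ⟨_, mul_mem (gateCZ_mem_gateGroup hω 0) (mul_mem (mul_mem (gateOn_H_mem hω 0)
      (gateOn_H_mem hω 1)) (mul_mem hk (idTensorHom_mem_gateGroup hω hg))),
      gateCZ_conj_XZ.comp ((h3.mul h4).comp (h2.comp
        (.mul (.of_eq (gateOn_zero_comm_idTensorHom u _).symm.eq) h1)))⟩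

/-- Every Pauli operator not commuting with `X_0` is conjugate to `Z_0` up to a phase by an
operator fixing `X_0` up to a phase. -/
theorem exists_conj_Z {ω : ℂ} (hω : IsPrimitiveRoot ω 8) (m : ℕ) (P : QUnitary (m + 1))
    (hP : P ∈ pauliGroup hω (m + 1)) (hXP : gateOn 0 matX * P ≠ P * gateOn 0 matX) :
    ∃ g ∈ gateGroup hω m, PhaseConj g (gateOn 0 matX) (gateOn 0 matX) ∧
      PhaseConj g P (gateOn 0 matZ) := by
  obtain ⟨u, hu, Q, hQ, rfl⟩ := exists_pauli_decomp hω hP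
  -- The factor `I ⊗ Q` commutes with `X_0`, so the failure to commute is already that of `u`.
  have hXu : matX * u ≠ u * matX := by
    intro e
    apply hXP
    rw [← mul_assoc, gateOn_mul, e, ← gateOn_mul, mul_assoc,
      (gateOn_zero_comm_idTensorHom matX Q).eq, mul_assoc]
  obtain ⟨k, hk, hkX, c, hc⟩ := exists_conj_matZ hω hu hXu
  have hk' := gateOn_mem_gateGroup hω (0 : Fin (m + 1)) hk
  have hkX' : PhaseConj (gateOn (0 : Fin (m + 1)) k) (gateOn 0 matX) (gateOn 0 matX) :=
    .of_eq (by rw [gateOn_mul, hkX, gateOn_mul])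
  by_cases hQ' : IsPhase Q
  · exact ⟨_, hk', hkX', (PhaseConj.gateOn 0 hc).mul_isPhase hQ'.idTensorHom⟩
  obtain _ | m := m
  · exact absurd (isPhase_zero Q) hQ'
  obtain ⟨g, hg, h⟩ := exists_conj_X hω m Q hQ hQ'
  have h1 := h.idTensorHom
  rw [idTensorHom_gateOn, Fin.succ_zero_eq_one] at h1
  obtain ⟨h3, h3', h4⟩ := hadamards_conj (0 : Fin (m + 2)) 1 Fin.zero_ne_one
  have e1 : PhaseConj (gateOn (0 : Fin (m + 2)) matH) (gateOn 0 matZ) (gateOn 0 matX) :=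
    .of_eq (by rw [gateOn_mul, matH_Z, gateOn_mul])
  have e2 : PhaseConj (gateOn (0 : Fin (m + 2)) matH) (gateOn 0 matX) (gateOn 0 matZ) :=
    .of_eq (by rw [gateOn_mul, matH_X, gateOn_mul])
  -- Up to phases, the Hadamard pair, the controlled `Z` and `H_0` act by `X_0 ↦ Z_0 ↦ Z_0 ↦ X_0`
  -- and `Z_0 X_1 ↦ X_0 Z_1 ↦ X_0 ↦ Z_0`.
  refine ⟨_, mul_mem (gateOn_H_mem hω 0) (mul_mem (gateCZ_mem_gateGroup hω 0)
    (mul_mem (mul_mem (gateOn_H_mem hω 0) (gateOn_H_mem hω 1))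
      (mul_mem hk' (idTensorHom_mem_gateGroup hω hg)))), ?_, ?_⟩
  · exact e1.comp ((gateCZ_comm_Z 0 0).comp (h3'.comp (hkX'.comp
      (.of_eq (gateOn_zero_comm_idTensorHom matX _).symm.eq))))
  · exact e2.comp (gateCZ_conj_XZ.comp ((h3.mul h4).comp (.comp
      (.mul (.gateOn 0 hc) (.of_eq (gateOn_comm Fin.zero_ne_one _ _)))
      (.mul (.of_eq (gateOn_zero_comm_idTensorHom u _).symm.eq) h1))))

/-! ### Peeling one qubit off a Clifford operator -/

theorem gateOn_X_mem {ω : ℂ} (hω : IsPrimitiveRoot ω 8) {m : ℕ} (i : Fin (m + 1)) :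
    gateOn i matX ∈ gateGroup hω m :=
  gateOn_mem_gateGroup hω i (matX_mem_closure hω)

theorem gateOn_Z_mem {ω : ℂ} (hω : IsPrimitiveRoot ω 8) {m : ℕ} (i : Fin (m + 1)) :
    gateOn i matZ ∈ gateGroup hω m :=
  gateOn_mem_gateGroup hω i (matZ_mem_closure hω)

theorem gateOn_Z_mul_X {n : ℕ} (i : Fin n) :
    (gateOn i matZ).1 * (gateOn i matX).1 = -((gateOn i matX).1 * (gateOn i matZ).1) := by
  change onQubit i _ * onQubit i _ = -(onQubit i _ * onQubit i _)
  rw [onQubit_mul, onQubit_mul, matZ_mul_matX, ← neg_one_smul ℂ, onQubit_smul, neg_one_smul]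

/-- An operator fixing `X_0` and `Z_0` up to phases becomes, after multiplication by a Pauli
operator on the first qubit, an operator commuting with both. -/
theorem exists_mul_commute {ω : ℂ} (hω : IsPrimitiveRoot ω 8) {m : ℕ} (W : QUnitary (m + 1))
    (hX : PhaseConj W (gateOn 0 matX) (gateOn 0 matX))
    (hZ : PhaseConj W (gateOn 0 matZ) (gateOn 0 matZ)) :
    ∃ p ∈ gateGroup hω m, p * W * gateOn 0 matX = gateOn 0 matX * (p * W) ∧
      p * W * gateOn 0 matZ = gateOn 0 matZ * (p * W) := by
  have hZX := gateOn_Z_mul_X (0 : Fin (m + 1))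
  -- If `W` anticommutes with `X_0`, then `Z_0 W` commutes with it. A remaining sign against `Z_0`
  -- is then removed by `X_0`, which does not disturb the relation with `X_0`.
  have step1 : ∃ p ∈ gateGroup hω m, p * W * gateOn 0 matX = gateOn 0 matX * (p * W) ∧
      PhaseConj (p * W) (gateOn 0 matZ) (gateOn 0 matZ) := by
    rcases hX.eq_or_eq_neg (gateOn_X_sq 0) with h | h
    · exact ⟨1, one_mem _, by rwa [one_mul], by rwa [one_mul]⟩
    · refine ⟨gateOn 0 matZ, gateOn_Z_mem hω 0, Subtype.ext ?_, PhaseConj.comp (.of_eq rfl) hZ⟩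
      change (gateOn 0 matZ).1 * W.1 * (gateOn 0 matX).1 =
        (gateOn 0 matX).1 * ((gateOn 0 matZ).1 * W.1)
      rw [mul_assoc, h, mul_neg, ← mul_assoc, hZX, neg_mul, neg_neg, mul_assoc]
  obtain ⟨p, hp, hpX, hpZ⟩ := step1
  rcases hpZ.eq_or_eq_neg (gateOn_Z_sq 0) with h | h
  · exact ⟨p, hp, hpX, h⟩
  · refine ⟨gateOn 0 matX * p, mul_mem (gateOn_X_mem hω 0) hp, ?_, Subtype.ext ?_⟩
    · rw [mul_assoc _ p, mul_assoc, hpX]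
    · change (gateOn 0 matX).1 * p.1 * W.1 * (gateOn 0 matZ).1 =
        (gateOn 0 matZ).1 * ((gateOn 0 matX).1 * p.1 * W.1)
      have h' : p.1 * W.1 * (gateOn 0 matZ).1 = -((gateOn 0 matZ).1 * (p.1 * W.1)) := h
      rw [mul_assoc _ p.1, mul_assoc, h', mul_neg, ← mul_assoc, ← mul_assoc (gateOn 0 matZ).1,
        hZX, neg_mul]

/-- The two anticommute, so commuting would force their product to be zero, although it is unitary.
-/
theorem gateOn_Z_mul_X_ne {n : ℕ} (i : Fin n) :
    gateOn i matZ * gateOn i matX ≠ gateOn i matX * gateOn i matZ := by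
  intro h
  have h2 : (gateOn i matZ).1 * (gateOn i matX).1 = (gateOn i matX).1 * (gateOn i matZ).1 :=
    congrArg Subtype.val h
  rw [gateOn_Z_mul_X] at h2
  have h3 : (gateOn i matX * gateOn i matZ).1 = 0 := by
    ext x y
    exact neg_eq_self.mp (congr_fun (congr_fun h2 x) y)
  have h4 := Matrix.mem_unitaryGroup_iff.mp (gateOn i matX * gateOn i matZ).2
  rw [h3, zero_mul] at h4
  exact zero_ne_one h4

theorem IsPhase.comm {n : ℕ} {P : QUnitary n} (h : IsPhase P) (V : QUnitary n) :
    V * P = P * V := by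
  obtain ⟨c, hc⟩ := h
  apply Subtype.ext
  change V.1 * P.1 = P.1 * V.1
  rw [hc, mul_smul_comm, smul_mul_assoc, one_mul, mul_one]

/-- A scalar conjugate would make `X_0` itself scalar, hence commuting with `Z_0`. -/
theorem not_isPhase_conj_X {m : ℕ} (U : QUnitary (m + 1)) :
    ¬ IsPhase (U * gateOn 0 matX * U⁻¹) := by
  intro h
  have h1 : U * gateOn 0 matX * U⁻¹ = gateOn 0 matX := by
    have := h.comm U
    rw [inv_mul_cancel_right] at this
    exact _root_.mul_left_cancel this
  rw [h1] at h
  exact gateOn_Z_mul_X_ne 0 (h.comm _)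

/-- Conjugation by `W` preserves commutation relations and fixes `X_0` up to a phase, so commuting
here would pull back to `X_0` and `Z_0`. -/
theorem gateOn_X_not_comm {m : ℕ} {W : QUnitary (m + 1)}
    (h : PhaseConj W (gateOn 0 matX) (gateOn 0 matX)) :
    gateOn 0 matX * (W * gateOn 0 matZ * W⁻¹) ≠ W * gateOn 0 matZ * W⁻¹ * gateOn 0 matX := by
  intro e
  obtain ⟨c, hc⟩ := h
  set Q := W * gateOn 0 matZ * W⁻¹ with hQ
  have hQW : Q * W = W * gateOn 0 matZ := by rw [hQ, inv_mul_cancel_right]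
  have hQW' : Q.1 * W.1 = W.1 * (gateOn 0 matZ).1 := congrArg Subtype.val hQW
  have e' : (gateOn 0 matX).1 * Q.1 = Q.1 * (gateOn 0 matX).1 := congrArg Subtype.val e
  have key : W * (gateOn 0 matZ * gateOn 0 matX) = W * (gateOn 0 matX * gateOn 0 matZ) := by
    apply Subtype.ext
    change W.1 * ((gateOn 0 matZ).1 * (gateOn 0 matX).1) =
      W.1 * ((gateOn 0 matX).1 * (gateOn 0 matZ).1)
    rw [← mul_assoc, ← hQW', mul_assoc, hc, mul_smul_comm, ← mul_assoc, ← e', mul_assoc, hQW',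
      ← mul_assoc, ← smul_mul_assoc, ← hc, mul_assoc]
  exact gateOn_Z_mul_X_ne 0 (_root_.mul_left_cancel key)

/-- The Clifford group is generated by the gates and the phases. -/
theorem exists_gateGroup_phase {ω : ℂ} (hω : IsPrimitiveRoot ω 8) (m : ℕ) :
    ∀ U ∈ cliffordGroup hω (m + 1), ∃ g ∈ gateGroup hω m, IsPhase (g * U) := by
  -- Gates can be chosen to undo the effect of `U` on `X_0` and `Z_0`, leaving an operator in their
  -- commutant.
  have reduce : ∀ (m : ℕ), ∀ U ∈ cliffordGroup hω (m + 1),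
      ∃ g ∈ gateGroup hω m, ∃ V ∈ cliffordGroup hω m, g * U = idTensorHom m V := by
    intro m U hU
    have hPauli : ∀ W ∈ cliffordGroup hω (m + 1), ∀ P ∈ pauliGroup hω (m + 1),
        W * P * W⁻¹ ∈ pauliGroup hω (m + 1) := fun W hW P hP =>
      (Subgroup.mem_normalizer_iff.mp hW P).mp hP
    have hself : ∀ W P : QUnitary (m + 1), PhaseConj W P (W * P * W⁻¹) := fun W P =>
      .of_eq (by group)
    obtain ⟨g, hg, h⟩ := exists_conj_X hω m _ (hPauli U hU _ (X_mem hω 0)) (not_isPhase_conj_X U)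
    have h1 := h.comp (hself U _)
    have hgU : g * U ∈ cliffordGroup hω (m + 1) := mul_mem (gateGroup_le_cliffordGroup hω m hg) hU
    obtain ⟨k, hk, hkX, hkZ⟩ := exists_conj_Z hω m _ (hPauli (g * U) hgU _ (Z_mem hω 0)) (by
      intro e
      exact gateOn_X_not_comm h1 e)
    obtain ⟨p, hp, hpX, hpZ⟩ := exists_mul_commute hω (k * (g * U)) (hkX.comp h1)
      (hkZ.comp (hself _ _))
    obtain ⟨V, hV⟩ := exists_idTensorHom_eq _ hpX hpZ
    refine ⟨p * k * g, mul_mem (mul_mem hp hk) hg, V,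
      mem_cliffordGroup_of_idTensorHom_mem hω ?_, ?_⟩
    · rw [hV]
      exact mul_mem (gateGroup_le_cliffordGroup hω m hp)
        (mul_mem (gateGroup_le_cliffordGroup hω m hk) hgU)
    · rw [hV]; simp only [mul_assoc]
  induction m with
  | zero =>
    intro U hU
    obtain ⟨g, hg, V, -, h⟩ := reduce 0 U hU
    exact ⟨g, hg, h ▸ (isPhase_zero V).idTensorHom⟩
  | succ m ih =>
    intro U hU
    obtain ⟨g, hg, V, hV, h⟩ := reduce _ U hU
    obtain ⟨k, hk, h'⟩ := ih V hV
    refine ⟨idTensorHom _ k * g, mul_mem (idTensorHom_mem_gateGroup hω hk) hg, ?_⟩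
    rw [mul_assoc, h, ← map_mul]
    exact h'.idTensorHom

/-! ### The centralizer -/

theorem trace_tensor {n : ℕ} (A : Fin n → Matrix (Fin 2) (Fin 2) ℂ) :
    (tensor A).trace = ∏ j, (A j).trace := by
  simp only [Matrix.trace, tensor, Matrix.diag_apply, Matrix.of_apply]
  rw [Finset.prod_univ_sum, Fintype.piFinset_univ]

/-- The trace is multiplicative over tensor factors, and each identity factor contributes 2. -/
theorem trace_onQubit_ne_zero {n : ℕ} (i : Fin n) {A : Matrix (Fin 2) (Fin 2) ℂ}
    (hA : A.trace ≠ 0) : (onQubit i A).trace ≠ 0 := by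
  rw [onQubit, trace_tensor, Finset.prod_ne_zero_iff]
  intro j _
  by_cases h : j = i
  · subst h; simpa using hA
  · simp [h]

/-- A unitary commuting with a matrix of nonzero trace up to a phase commutes with it. -/
theorem PhaseConj.comm_of_trace_ne_zero {n : ℕ} {U A : QUnitary n} (h : PhaseConj U A A)
    (hA : A.1.trace ≠ 0) : U * A = A * U := by
  obtain ⟨c, hc⟩ := h
  have hU : U.1 * star U.1 = 1 := Matrix.mem_unitaryGroup_iff.mp U.2
  -- Conjugation by `U` preserves the trace, so the phase must fix the trace of `A`.
  have e : A.1.trace = c * A.1.trace := by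
    calc A.1.trace = (star U.1 * (U.1 * A.1)).trace := by
          rw [← mul_assoc, Matrix.mem_unitaryGroup_iff'.mp U.2, one_mul]
      _ = c * (star U.1 * (A.1 * U.1)).trace := by
          rw [hc, mul_smul_comm, Matrix.trace_smul, smul_eq_mul]
      _ = _ := by rw [Matrix.trace_mul_comm, mul_assoc, hU, mul_one]
  have hc1 : c = 1 := mul_right_cancel₀ hA (by rw [← e, one_mul])
  apply Subtype.ext
  change U.1 * A.1 = A.1 * U.1
  rw [hc, hc1, one_smul]

/-! ### Projective classes and the embedding of the smaller group -/

theorem proj_eq_iff {ω : ℂ} (hω : IsPrimitiveRoot ω 8) {n : ℕ} (U V : cliffordGroup hω n) :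
    proj hω n U = proj hω n V ↔ IsPhase (U⁻¹ * V : QUnitary n) :=
  QuotientGroup.eq

theorem phaseConj_of_proj_comm {ω : ℂ} (hω : IsPrimitiveRoot ω 8) {n : ℕ}
    {U A : cliffordGroup hω n}
    (h : proj hω n A * proj hω n U = proj hω n U * proj hω n A) :
    PhaseConj (U : QUnitary n) A A := by
  rw [← map_mul, ← map_mul, proj_eq_iff] at h
  obtain ⟨c, hc⟩ := h
  refine ⟨c, ?_⟩
  have e : (A * U : QUnitary n) * ((A * U : QUnitary n)⁻¹ * (U * A : QUnitary n)) = U * A := by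
    group
  have e' := congrArg Subtype.val e
  change U.1.1 * A.1.1 = c • (A.1.1 * U.1.1)
  change (A.1 * U.1).1 * ((A * U : QUnitary n)⁻¹ * (U * A : QUnitary n)).1 = U.1.1 * A.1.1 at e'
  rw [← e']
  change (A.1 * U.1).1 * (((A * U)⁻¹ * (U * A) : cliffordGroup hω n) : QUnitary n).1 = _
  rw [show (((A * U)⁻¹ * (U * A) : cliffordGroup hω n) : QUnitary n).1 = c • 1 from hc,
    mul_smul_comm, mul_one]
  rfl

/-- The embedding `[U] ↦ [I ⊗ U]` on Clifford groups. -/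
noncomputable def cliffordEmb {ω : ℂ} (hω : IsPrimitiveRoot ω 8) (m : ℕ) :
    cliffordGroup hω m →* cliffordGroup hω (m + 1) :=
  ((idTensorHom m).comp (cliffordGroup hω m).subtype).codRestrict _
    fun U => idTensorHom_mem_cliffordGroup hω U.2

/-- The embedding `[U] ↦ [I ⊗ U]` on projective Clifford groups. -/
noncomputable def projEmb {ω : ℂ} (hω : IsPrimitiveRoot ω 8) (m : ℕ) :
    ProjClifford hω m →* ProjClifford hω (m + 1) :=
  QuotientGroup.map _ _ (cliffordEmb hω m) fun U (hU : IsPhase (U : QUnitary m)) =>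
    hU.idTensorHom

theorem projEmb_proj {ω : ℂ} (hω : IsPrimitiveRoot ω 8) {m : ℕ} (U : cliffordGroup hω m) :
    projEmb hω m (proj hω m U) = proj hω (m + 1) (cliffordEmb hω m U) := rfl

theorem proj_surjective {ω : ℂ} (hω : IsPrimitiveRoot ω 8) (n : ℕ) :
    Function.Surjective (proj hω n) :=
  QuotientGroup.mk'_surjective _

theorem isPhase_of_idTensorHom {m : ℕ} {U : QUnitary m} (h : IsPhase (idTensorHom m U)) :
    IsPhase U := by
  obtain ⟨c, hc⟩ := h
  refine ⟨c, idTensor_injective ?_⟩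
  rw [idTensor_smul, idTensor_one, ← hc, idTensorHom_val]

theorem projEmb_injective {ω : ℂ} (hω : IsPrimitiveRoot ω 8) (m : ℕ) :
    Function.Injective (projEmb hω m) := by
  rw [injective_iff_map_eq_one]
  intro a
  obtain ⟨U, rfl⟩ := proj_surjective hω m a
  intro h
  exact (QuotientGroup.eq_one_iff U).mpr
    (isPhase_of_idTensorHom ((QuotientGroup.eq_one_iff (cliffordEmb hω m U)).mp h))

/-- The operator `H S H` on qubit `i`. -/
noncomputable def gateHSH {ω : ℂ} (hω : IsPrimitiveRoot ω 8) {n : ℕ} (i : Fin n) :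
    cliffordGroup hω n :=
  ⟨gateOn i matH, gateH_mem hω i⟩ * ⟨gateOn i (matS hω), gateS_mem hω i⟩ *
    ⟨gateOn i matH, gateH_mem hω i⟩

theorem gateHSH_val {ω : ℂ} (hω : IsPrimitiveRoot ω 8) {n : ℕ} (i : Fin n) :
    (gateHSH hω i : QUnitary n) = gateOn i (matH * matS hω * matH) := by
  rw [← gateOn_mul, ← gateOn_mul]; rfl

/-- If `1 + ω² = 0` then `ω⁴ = 1`, whereas `ω⁴ = -1`. -/
theorem trace_matS_ne_zero {ω : ℂ} (hω : IsPrimitiveRoot ω 8) : (matS hω).1.trace ≠ 0 := by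
  have h := root_pow_four hω
  simp only [matS, Matrix.trace_fin_two_of]
  intro e
  have e2 : ω ^ 2 = -1 := by linear_combination e
  have : ω ^ 4 = 1 := by rw [show ω ^ 4 = (ω ^ 2) ^ 2 by ring, e2]; norm_num
  rw [this] at h
  norm_num at h

theorem trace_HSH {ω : ℂ} (hω : IsPrimitiveRoot ω 8) :
    (matH * matS hω * matH).1.trace = (matS hω).1.trace := by
  change (matH.1 * (matS hω).1 * matH.1).trace = _
  have hH : matH.1 * matH.1 = 1 := congrArg Subtype.val matH_sq
  rw [Matrix.trace_mul_comm, ← mul_assoc, hH, one_mul]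

/-- Nonzero traces upgrade projective commutation to genuine commutation; squaring then gives the
commutant of `X_0` and `Z_0`, namely the operators `I ⊗ V`. -/
theorem range_projEmb {ω : ℂ} (hω : IsPrimitiveRoot ω 8) (m : ℕ) :
    (projEmb hω m).range = commonCentralizer hω m := by
  have hHSH : hGate hω (0 : Fin (m + 1)) * sGate hω 0 * hGate hω 0 =
      proj hω (m + 1) (gateHSH hω 0) := rfl
  ext a
  rw [commonCentralizer, Subgroup.mem_centralizer_iff, hHSH]
  simp only [Set.mem_insert_iff, Set.mem_singleton_iff, forall_eq_or_imp, forall_eq]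
  constructor
  · rintro ⟨b, rfl⟩
    obtain ⟨U, rfl⟩ := proj_surjective hω m b
    rw [projEmb_proj]
    have h : ∀ u, ∀ A : cliffordGroup hω (m + 1), (A : QUnitary (m + 1)) = gateOn 0 u →
        proj hω (m + 1) A * proj hω (m + 1) (cliffordEmb hω m U) =
          proj hω (m + 1) (cliffordEmb hω m U) * proj hω (m + 1) A := by
      intro u A hA
      rw [← map_mul, ← map_mul]
      congr 1
      apply Subtype.ext
      change A.1 * idTensorHom m U = idTensorHom m U * A.1
      rw [hA]
      exact (gateOn_zero_comm_idTensorHom u _).eq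
    exact ⟨h _ _ rfl, h _ _ (gateHSH_val hω 0)⟩
  · obtain ⟨U, rfl⟩ := proj_surjective hω _ a
    rintro ⟨h1, h2⟩
    have hS : U.1 * gateOn 0 (matS hω) = gateOn 0 (matS hω) * U.1 :=
      (phaseConj_of_proj_comm hω h1).comm_of_trace_ne_zero
        (trace_onQubit_ne_zero 0 (trace_matS_ne_zero hω))
    have h2' := phaseConj_of_proj_comm hω h2
    rw [gateHSH_val] at h2'
    have hT := h2'.comm_of_trace_ne_zero (trace_onQubit_ne_zero 0
      (by rw [trace_HSH]; exact trace_matS_ne_zero hω))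
    -- `(HSH)² = H S² H = H Z H = X`, so commuting with `HSH` implies commuting with `X`.
    have hsq : matH * matS hω * matH * (matH * matS hω * matH) = matX := by
      calc _ = matH * matS hω * (matH * matH) * matS hω * matH := by group
        _ = matH * (matS hω * matS hω) * matH := by rw [matH_sq]; group
        _ = _ := by rw [matS_sq, matH_matZ_matH]
    obtain ⟨V, hV⟩ := exists_idTensorHom_eq U.1
      (by
        rw [← hsq, ← gateOn_mul]
        exact Commute.mul_right hT hT)
      (by
        rw [← matS_sq hω, ← gateOn_mul]
        exact Commute.mul_right hS hS)
    refine ⟨proj hω m ⟨V, mem_cliffordGroup_of_idTensorHom_mem hω (hV ▸ U.2)⟩, ?_⟩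
    rw [projEmb_proj]
    congr 1
    exact Subtype.ext hV

/-- The operators acting on the qubits other than the first are generated by the gates on them. -/
theorem range_projEmb_eq_closure {ω : ℂ} (hω : IsPrimitiveRoot ω 8) (m : ℕ) :
    (projEmb hω (m + 1)).range = Subgroup.closure
      ({g | ∃ i : Fin (m + 2), i ≠ 0 ∧ g = hGate hω i} ∪
        {g | ∃ i : Fin (m + 2), i ≠ 0 ∧ g = sGate hω i} ∪
        {g | ∃ j : Fin (m + 1), (j : ℕ) ≠ 0 ∧ g = lamGate hω j}) := by
  set K := Subgroup.closure
      ({g | ∃ i : Fin (m + 2), i ≠ 0 ∧ g = hGate hω i} ∪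
        {g | ∃ i : Fin (m + 2), i ≠ 0 ∧ g = sGate hω i} ∪
        {g | ∃ j : Fin (m + 1), (j : ℕ) ≠ 0 ∧ g = lamGate hω j}) with hK
  have hh : ∀ i : Fin (m + 1), projEmb hω (m + 1) (hGate hω i) = hGate hω i.succ := fun i =>
    congrArg (proj hω (m + 2)) (Subtype.ext (idTensorHom_gateOn i _))
  have hs : ∀ i : Fin (m + 1), projEmb hω (m + 1) (sGate hω i) = sGate hω i.succ := fun i =>
    congrArg (proj hω (m + 2)) (Subtype.ext (idTensorHom_gateOn i _))
  have hl : ∀ i : Fin m, projEmb hω (m + 1) (lamGate hω i) = lamGate hω i.succ := fun i =>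
    congrArg (proj hω (m + 2)) (Subtype.ext (idTensorHom_gateCZ i))
  apply le_antisymm
  · rintro _ ⟨a, rfl⟩
    obtain ⟨U, rfl⟩ := proj_surjective hω _ a
    -- The gate group lives in the unitary group, so the condition on embedded classes is pushed
    -- forward there from the Clifford group and checked on generators.
    have hle : gateGroup hω m ≤ ((K.comap (projEmb hω (m + 1))).comap (proj hω (m + 1))).map
        (cliffordGroup hω (m + 1)).subtype := by
      rw [gateGroup_le_iff]
      refine ⟨fun i => ⟨⟨_, gateH_mem hω i⟩, ?_, rfl⟩, fun i => ⟨⟨_, gateS_mem hω i⟩, ?_, rfl⟩,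
        fun i => ⟨⟨_, gateCZ_mem hω i⟩, ?_, rfl⟩⟩
      · change projEmb hω (m + 1) (hGate hω i) ∈ K
        rw [hh]
        exact Subgroup.subset_closure (Or.inl (Or.inl ⟨_, Fin.succ_ne_zero i, rfl⟩))
      · change projEmb hω (m + 1) (sGate hω i) ∈ K
        rw [hs]
        exact Subgroup.subset_closure (Or.inl (Or.inr ⟨_, Fin.succ_ne_zero i, rfl⟩))
      · change projEmb hω (m + 1) (lamGate hω i) ∈ K
        rw [hl]
        exact Subgroup.subset_closure (Or.inr ⟨_, by simp, rfl⟩)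
    obtain ⟨g, hg, hgU⟩ := exists_gateGroup_phase hω m U U.2
    -- As `g U` is scalar, `U` has the class of `g⁻¹`, not of `g`.
    obtain ⟨G, hG, hGg⟩ := hle (inv_mem hg)
    have e : proj hω (m + 1) G = proj hω (m + 1) U := by
      rw [proj_eq_iff]
      have hgG : (G : QUnitary (m + 1))⁻¹ = g := inv_eq_iff_eq_inv.mpr hGg
      rw [← hgG] at hgU
      exact hgU
    rw [← e]
    exact hG
  · rw [hK, Subgroup.closure_le]
    rintro _ ((⟨i, hi, rfl⟩ | ⟨i, hi, rfl⟩) | ⟨j, hj, rfl⟩)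
    · obtain ⟨i, rfl⟩ := Fin.exists_succ_eq.mpr hi
      exact ⟨_, hh i⟩
    · obtain ⟨i, rfl⟩ := Fin.exists_succ_eq.mpr hi
      exact ⟨_, hs i⟩
    · obtain ⟨j, rfl⟩ := Fin.exists_succ_eq.mpr fun h => hj (congrArg Fin.val h)
      exact ⟨_, hl j⟩

end QubitClifford

theorem mainTheorem6 (ω : ℂ) (hω : IsPrimitiveRoot ω 8) :
    QubitClifford.commonCentralizer hω 0 = ⊥ ∧
    QubitClifford.commonCentralizer hω 1 =
      Subgroup.closure {QubitClifford.hGate hω 1, QubitClifford.sGate hω 1} ∧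
    ∀ m : ℕ, 2 ≤ m →
      QubitClifford.commonCentralizer hω m =
        Subgroup.closure
          ({g | ∃ i : Fin (m + 1), i ≠ 0 ∧ g = QubitClifford.hGate hω i} ∪
            {g | ∃ i : Fin (m + 1), i ≠ 0 ∧ g = QubitClifford.sGate hω i} ∪
            {g | ∃ j : Fin m, (j : ℕ) ≠ 0 ∧ g = QubitClifford.lamGate hω j}) ∧
      ∃ φ : QubitClifford.ProjClifford hω m →* QubitClifford.ProjClifford hω (m + 1),
        Function.Injective φ ∧
        (∀ U : QubitClifford.cliffordGroup hω m,
          ∃ V : QubitClifford.cliffordGroup hω (m + 1),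
            ((V : QubitClifford.QUnitary (m + 1)) : QubitClifford.QMatrix (m + 1)) =
              QubitClifford.idTensor ((U : QubitClifford.QUnitary m) : QubitClifford.QMatrix m) ∧
            φ (QubitClifford.proj hω m U) = QubitClifford.proj hω (m + 1) V) ∧
        φ.range = QubitClifford.commonCentralizer hω m := by
  open QubitClifford in
  refine ⟨?_, ?_, fun m hm => ⟨?_, projEmb hω m, projEmb_injective hω m,
    fun U => ⟨cliffordEmb hω m U, rfl, rfl⟩, range_projEmb hω m⟩⟩
  -- On one qubit the image comes from zero qubits, where every operator is a phase.
  · rw [← range_projEmb, eq_bot_iff]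
    rintro _ ⟨a, rfl⟩
    obtain ⟨U, rfl⟩ := proj_surjective hω 0 a
    rw [show proj hω 0 U = 1 from (QuotientGroup.eq_one_iff U).mpr (isPhase_zero U.1), map_one]
    exact one_mem _
  -- With two qubits the only index of a controlled `Z` is 0, so that family of generators is empty.
  · rw [← range_projEmb, range_projEmb_eq_closure]
    congr 1
    ext g
    simp [Fin.exists_fin_succ, or_comm]
  · obtain ⟨m, rfl⟩ := Nat.exists_eq_add_of_le' (le_trans one_le_two hm)
    rw [← range_projEmb, range_projEmb_eq_closure]
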